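/- **Setting.** Let $n\ge 1$, let $M$ be a (Hausdorff) smooth manifold of dimension $n+1$, and let $g_0$ be a smooth symmetric $(0,2)$-tensor field on $M$ of constant rank $n$ whose radical $TM^{\perp}=\ker g_0$ is spanned by a nowhere vanishing smooth vector field $\xi$. Assume that $(M,g_0)$ is totally geodesic: its second fundamental form $B(Y,Z)=-\tfrac12\big(\xi\cdot g_0(Y,Z)-g_0([\xi,Y],Z)-g_0(Y,[\xi,Z])\big)$ vanishes. (If $g_0$ is induced on a lightlike hypersurface of a pseudo-Riemannian manifold $(\overline M,\overline g)$ with Levi-Civita connection $\overline\nabla$, then $B(Y,Z)=\overline g(\overline\nabla_YZ,\xi)$ by the Koszul formula, so this is the usual notion.) Let $c$ be the set of all $g=e^{-2f}g_0$ with $f\in C^\infty(M)$ and $\xi\cdot f=0$. Let $S(TM)$ be an integrable smooth distribution with $TM=S(TM)\oplus TM^\perp$, and let $\eta$ be the $1$-form with $\eta(\xi)=1$ and $\ker\eta=S(TM)$. For a smooth linear connection $\nabla$ put $R^\nabla(X,Y)=\nabla_{[X,Y]}-[\nabla_X,\nabla_Y]$ and let $\mathrm{Ric}^\nabla(X,Y)$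 be the trace of $Z\mapsto R^\nabla(X,Z)Y$. A *Weyl screen structure* on $(M,c,S(TM))$ is a smooth torsion-free linear connection $D$ such that for each $g\in c$ there is a unique $1$-form $\alpha$ with $Dg=-2\alpha\otimes g$, and such that $D_XY\in\Gamma(S(TM))$ for all $X\in\Gamma(TM)$, $Y\in\Gamma(S(TM))$. It is *Einstein-Weyl* if moreover for each $g\in c$ there is $\wedge\in C^\infty(M)$, an Einstein-Weyl function of $D$ with respect to $g$, such that $\mathrm{Ric}^D(X,Y)+\mathrm{Ric}^D(Y,X)=\wedge\, g(X,Y)$ for all $X,Y$. For $g\in c$ let $D^g$ denote a smooth torsion-free linear connection with $D^gg=0$ and $D^g_\xi\xi=0$. Let $\varphi_g$ be the $1$-form with $D^g_X\xi=\varphi_g(X)\xi$, let $C(X,Y)=\eta(D^g_XY)$ for $Y\in\Gamma(S(TM))$ be the second fundamental form of $S(TM)$, let $\mathrm{Ric}^g$ be the Ricci curvature of $D^g$, and let $d\varphi_g(X,Y)=\tfrac12\big(X\cdot\varphi_g(Y)-Y\cdot\varphi_g(X)-\varphi_g([X,Y])\big)$. For a $1$-form $\theta$ let $\theta^{\sharp}$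 be the vector field with $g(\theta^\sharp,\cdot)+\eta(\theta^\sharp)\eta=\theta$, and put $|\theta^\sharp|^2=g(\theta^\sharp,\theta^\sharp)$ and $\delta^g\theta=\mathrm{tr}(Z\mapsto D^g_Z\theta^\sharp)$. Say that a linear connection $D$ *is given by* $(g,D^g,\theta_g,S)$ if $\theta_g$ is a smooth $1$-form with $\theta_g(\xi)=0$, $S$ is a smooth symmetric $(0,2)$-tensor field with $S(\xi,\xi)=0$ and $S(X,Y)=C(X,Y)+\eta(X)\theta_g(Y)$ for all $X\in\Gamma(TM)$, $Y\in\Gamma(S(TM))$, and $$D_XY=D^g_XY+\theta_g(X)Y+\theta_g(Y)X-g(X,Y)\,\theta_g^\sharp-S(X,Y)\,\xi .\tag{1}$$ In that case put $$\begin{aligned}\mathcal D(\theta_g)(X,Y)={}&(1-n)\big[(D^g_X\theta_g)(Y)+(D^g_Y\theta_g)(X)-2\theta_g(X)\theta_g(Y)\big]+\big[(D^g_XS)(\xi,Y)+(D^g_YS)(\xi,X)\big]\\&+\big[\varphi_g(X)S(\xi,Y)+\varphi_g(Y)S(\xi,X)\big]-2\big[(D^g_\xi S)(X,Y)+S(\xi,X)S(\xi,Y)\big],\end{aligned}$$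 and, for $\wedge\in C^\infty(M)$, $$\bar\wedge=\tfrac12\wedge-\big[(1-n)|\theta_g^\sharp|^2-\delta^g\theta_g+S(\xi,\theta_g^\sharp)\big],\qquad \mathrm{Ric}^g=-d\varphi_g-\tfrac12\,\mathcal D(\theta_g)+\bar\wedge\, g .\tag{2}$$ **Proposition.** Let $D$ be a smooth linear connection on $M$ and suppose that $\xi$ is normalized by $D_\xi\xi=0$. (a) $(M,c,S(TM),D)$ is an Einstein-Weyl screen structure if and only if for every $g\in c$ there are $D^g,\theta_g,S$ and $\wedge$ such that $D$ is given by $(g,D^g,\theta_g,S)$ as in (1) and (2) holds. (b) If $(M,c,S(TM),D)$ is an Einstein-Weyl screen structure, then for every $g\in c$ and every choice of $D^g$ there are $\theta_g$, $S$ and $\wedge$ such that $D$ is given by $(g,D^g,\theta_g,S)$ and (2) holds. (c) Whenever $g\in c$ and $D$ is given by $(g,D^g,\theta_g,S)$, a function $\wedge\in C^\infty(M)$ is an Einstein-Weyl function of $D$ with respect to $g$ if and only if (2) holds. -/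

import Mathlib

open scoped Manifold ContDiff

namespace LightlikeWeyl

noncomputable section

/-! ## Tensor fields, connections, curvature -/

/-- The model space of an `(n + 1)`-dimensional manifold. -/
abbrev E (n : ℕ) : Type := EuclideanSpace ℝ (Fin (n + 1))

section Basic

variable (n : ℕ) (M : Type*) [TopologicalSpace M] [ChartedSpace (E n) M]
  [IsManifold (𝓡 (n + 1)) ∞ M]

/-- Smooth vector fields on the `(n + 1)`-dimensional manifold `M`. -/
abbrev VF := ContMDiffSection (𝓡 (n + 1)) (E n) ∞
  (fun p : M ↦ TangentSpace (𝓡 (n + 1)) p)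

/-- Smooth `1`-forms on `M`. -/
abbrev OneForm := ContMDiffSection (𝓡 (n + 1)) (E n →L[ℝ] ℝ) ∞
  (fun p : M ↦ TangentSpace (𝓡 (n + 1)) p →L[ℝ] ℝ)

/-- Smooth `(0,2)`-tensor fields on `M`. -/
abbrev BilinForm := ContMDiffSection (𝓡 (n + 1)) (E n →L[ℝ] E n →L[ℝ] ℝ) ∞
  (fun p : M ↦ TangentSpace (𝓡 (n + 1)) p →L[ℝ] TangentSpace (𝓡 (n + 1)) p →L[ℝ] ℝ)

/-- Smooth real functions on `M`. -/
abbrev SmoothFun := ContMDiffMap (𝓡 (n + 1)) 𝓘(ℝ, ℝ) M ℝ ∞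

/-- A smooth linear connection on `M`; `D.cov Y p v` is the vector `D_v Y` at `p`. -/
structure Connection where
  cov : CovariantDerivative (𝓡 (n + 1)) (E n) (fun p : M ↦ TangentSpace (𝓡 (n + 1)) p)
  smooth : CovariantDerivative.ContMDiffCovariantDerivative cov ∞

end Basic

variable {n : ℕ} {M : Type*} [TopologicalSpace M] [ChartedSpace (E n) M]
  [IsManifold (𝓡 (n + 1)) ∞ M]

/-- The directional derivative `v · f` of a function `f` along a tangent vector `v` at `p`. -/
def dirD (f : M → ℝ) (p : M) (v : TangentSpace (𝓡 (n + 1)) p) : ℝ :=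
  mvfderiv (𝓡 (n + 1)) f p v

/-- The Lie bracket `[X, Y]`. -/
def bracket (X Y : ∀ p : M, TangentSpace (𝓡 (n + 1)) p) (p : M) : TangentSpace (𝓡 (n + 1)) p :=
  VectorField.mlieBracket (𝓡 (n + 1)) X Y p

/-- The covariant derivative `D_X Y`. -/
def Connection.nabla (D : Connection n M) (X Y : ∀ p : M, TangentSpace (𝓡 (n + 1)) p) (p : M) :
    TangentSpace (𝓡 (n + 1)) p :=
  D.cov Y p (X p)

/-- `D` is torsion-free (symmetric): `D_X Y - D_Y X = [X, Y]`. -/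
def Connection.IsTorsionFree (D : Connection n M) : Prop :=
  ∀ (X Y : VF n M) (p : M), D.nabla X Y p - D.nabla Y X p = bracket X Y p

/-- `(D_Z θ)(Y)` for a `1`-form `θ`. -/
def Connection.derivForm (D : Connection n M) (θ : ∀ p : M, TangentSpace (𝓡 (n + 1)) p →L[ℝ] ℝ)
    (Z Y : VF n M) (p : M) : ℝ :=
  dirD (fun q ↦ θ q (Y q)) p (Z p) - θ p (D.nabla Z Y p)

/-- `(D_Z S)(X, Y)` for a `(0,2)`-tensor field `S`. -/
def Connection.derivBilin (D : Connection n M) (S : BilinForm n M) (Z X Y : VF n M) (p : M) : ℝ :=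
  dirD (fun q ↦ S q (X q) (Y q)) p (Z p) - S p (D.nabla Z X p) (Y p) - S p (X p) (D.nabla Z Y p)

/-- The curvature `R^D(X, Y) Z = D_{[X,Y]} Z - (D_X D_Y Z - D_Y D_X Z)`. -/
def Connection.curv (D : Connection n M) (X Y Z : ∀ p : M, TangentSpace (𝓡 (n + 1)) p) (p : M) :
    TangentSpace (𝓡 (n + 1)) p :=
  D.nabla (bracket X Y) Z p -
    (D.nabla X (D.nabla Y Z) p - D.nabla Y (D.nabla X Z) p)

/-- `D_Z Y` is differentiable at `p` if `Z` is. -/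
theorem Connection.mdifferentiableAt_nabla (D : Connection n M) (Y : VF n M) {p : M}
    {Z : ∀ q : M, TangentSpace (𝓡 (n + 1)) q}
    (hZ : MDifferentiableAt (𝓡 (n + 1)) ((𝓡 (n + 1)).prod 𝓘(ℝ, E n))
      (fun q ↦ Bundle.TotalSpace.mk' (E n) q (Z q)) p) :
    MDifferentiableAt (𝓡 (n + 1)) ((𝓡 (n + 1)).prod 𝓘(ℝ, E n))
      (fun q ↦ Bundle.TotalSpace.mk' (E n) q (D.nabla Z Y q)) p := by
  have hY : ContMDiffOn (𝓡 (n + 1)) ((𝓡 (n + 1)).prod 𝓘(ℝ, E n)) (∞ + 1)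
      (fun q ↦ Bundle.TotalSpace.mk' (E n) q (Y q)) Set.univ := Y.contMDiff.contMDiffOn
  have h := (D.smooth.contMDiff.contMDiff hY) p (Set.mem_univ p)
  have h' := (h.contMDiffAt Filter.univ_mem).mdifferentiableAt (by simp)
  exact MDifferentiableAt.clm_bundle_apply h' hZ

/-- `R^D(X, Z) Y` depends, at a point, only on the value of `Z` at that point. -/
theorem Connection.curv_tensorial (D : Connection n M) (X Y : VF n M) (p : M) :
    TensorialAt (𝓡 (n + 1)) (E n)
      (fun Z : (∀ q : M, TangentSpace (𝓡 (n + 1)) q) ↦ D.curv X Z Y p) p where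
  smul {f Z} hf hZ := by
    have h1 : D.nabla (f • Z) Y = f • D.nabla Z Y := by
      funext q; simp [Connection.nabla]
    have h2 : bracket X (f • Z) p = dirD f p (X p) • Z p + f p • bracket X Z p :=
      VectorField.mlieBracket_smul_right hf hZ
    have h3 := D.cov.isCovariantDerivativeOnUniv.leibniz (D.mdifferentiableAt_nabla Y hZ) hf
    simp only [Connection.curv, h1]
    simp only [Connection.nabla, h2] at h3 ⊢
    rw [h3]
    simp [dirD]
    module
  add {Z Z'} hZ hZ' := by
    have h1 : D.nabla (Z + Z') Y = D.nabla Z Y + D.nabla Z' Y := by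
      funext q; simp [Connection.nabla]
    have h2 : bracket X (Z + Z') p = bracket X Z p + bracket X Z' p :=
      VectorField.mlieBracket_add_right hZ hZ'
    have h3 := D.cov.isCovariantDerivativeOnUniv.add (D.mdifferentiableAt_nabla Y hZ)
      (D.mdifferentiableAt_nabla Y hZ')
    simp only [Connection.curv, h1]
    simp only [Connection.nabla, h2] at h3 ⊢
    rw [h3]
    simp
    module

/-- The endomorphism `Z ↦ R^D(X, Z) Y` of the tangent space at `p`. -/
def Connection.curvEnd (D : Connection n M) (X Y : VF n M) (p : M) :
    TangentSpace (𝓡 (n + 1)) p →L[ℝ] TangentSpace (𝓡 (n + 1)) p :=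
  TensorialAt.mkHom _ p (D.curv_tensorial X Y p)

/-- The Ricci curvature `Ric^D(X, Y)`: the trace of `Z ↦ R^D(X, Z) Y`. -/
def Connection.ric (D : Connection n M) (X Y : VF n M) (p : M) : ℝ :=
  LinearMap.trace ℝ (TangentSpace (𝓡 (n + 1)) p) (D.curvEnd X Y p).toLinearMap

/-- The divergence `div W`: the trace of `Z ↦ D_Z W`. -/
def Connection.div (D : Connection n M) (W : ∀ p : M, TangentSpace (𝓡 (n + 1)) p) (p : M) : ℝ :=
  LinearMap.trace ℝ (TangentSpace (𝓡 (n + 1)) p) (D.cov W p).toLinearMap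

/-- The exterior derivative, `dα(X, Y) = ½ (X·α(Y) - Y·α(X) - α([X, Y]))`. -/
def extD (α : ∀ p : M, TangentSpace (𝓡 (n + 1)) p →L[ℝ] ℝ) (X Y : VF n M) (p : M) : ℝ :=
  (1 / 2) * (dirD (fun q ↦ α q (Y q)) p (X p) - dirD (fun q ↦ α q (X q)) p (Y p)
    - α p (bracket X Y p))

/-! ## Lightlike metrics, conformal classes, screen distributions -/

/-- `g` is symmetric and degenerate of constant rank `n`; its radical `TM^⊥` is spanned at every
point by the nowhere vanishing vector field `ξ`. -/
structure IsLightlike (g : BilinForm n M) (ξ : VF n M) : Prop where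
  symm : ∀ (p : M) (v w : TangentSpace (𝓡 (n + 1)) p), g p v w = g p w v
  ne_zero : ∀ p : M, ξ p ≠ 0
  radical : ∀ (p : M) (v : TangentSpace (𝓡 (n + 1)) p),
    (∀ w, g p v w = 0) ↔ ∃ a : ℝ, v = a • ξ p

/-- The second fundamental form `B` with respect to `ξ`. If `(M, g)` is a lightlike hypersurface of
a pseudo-Riemannian manifold `(N, h)` with Levi-Civita connection `∇`, then `B(Y, Z) = h(∇_Y Z, ξ)`,
and since `h(ξ, ·) = 0` on `TM` the Koszul formula that defines `∇` reads
`2 B(Y, Z) = -(ξ·g(Y, Z) - g([ξ, Y], Z) - g(Y, [ξ, Z]))`, an expression in `g` alone. -/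
def secondFundamentalForm (g : BilinForm n M) (ξ : VF n M) (Y Z : VF n M) (p : M) : ℝ :=
  -(1 / 2) * (dirD (fun q ↦ g q (Y q) (Z q)) p (ξ p) - g p (bracket ξ Y p) (Z p)
    - g p (Y p) (bracket ξ Z p))

/-- `(M, g)` is totally geodesic: its second fundamental form vanishes. -/
def IsTotallyGeodesic (g : BilinForm n M) (ξ : VF n M) : Prop :=
  ∀ (Y Z : VF n M) (p : M), secondFundamentalForm g ξ Y Z p = 0

/-- The conformal structure `c = [g₀]₀`: all `g = e^{-2f} g₀` with `f` smooth and `ξ·f = 0`. -/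
def conformalClass (g₀ : BilinForm n M) (ξ : VF n M) : Set (BilinForm n M) :=
  {g | ∃ f : SmoothFun n M, (∀ p, dirD f p (ξ p) = 0) ∧
    ∀ (p : M) (v w : TangentSpace (𝓡 (n + 1)) p), g p v w = Real.exp (-2 * f p) * g₀ p v w}

/-- A screen distribution: a smooth distribution `S(TM)` complementary to the line bundle spanned
by `ξ`. It is given by the `1`-form `η` of the decomposition `X = PX + η(X) ξ`, `PX ∈ S(TM)`;
the smooth complements of the line bundle and the smooth `1`-forms `η` with `η(ξ) = 1` correspond
to each other through `S(TM) = ker η`. -/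
structure ScreenDistribution (ξ : VF n M) where
  η : OneForm n M
  η_ξ : ∀ p : M, η p (ξ p) = 1

/-- The fibre of the distribution `S(TM)` at `p`. -/
def ScreenDistribution.space {ξ : VF n M} (S : ScreenDistribution ξ) (p : M) :
    Submodule ℝ (TangentSpace (𝓡 (n + 1)) p) :=
  LinearMap.ker (S.η p).toLinearMap

/-- `Y` is a section of `S(TM)`. -/
def ScreenDistribution.IsSection {ξ : VF n M} (S : ScreenDistribution ξ) (Y : VF n M) : Prop :=
  ∀ p : M, Y p ∈ S.space p

/-- `S(TM)` is integrable: the bracket of two sections of `S(TM)` takes values in `S(TM)`. -/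
def ScreenDistribution.IsIntegrable {ξ : VF n M} (S : ScreenDistribution ξ) : Prop :=
  ∀ X Y : VF n M, S.IsSection X → S.IsSection Y → ∀ p, bracket X Y p ∈ S.space p

/-- The isomorphism `X ↦ X^♭ = g(X, ·) + η(X) η`. -/
def flat (g : BilinForm n M) (η : OneForm n M) (p : M) :
    TangentSpace (𝓡 (n + 1)) p →L[ℝ] (TangentSpace (𝓡 (n + 1)) p →L[ℝ] ℝ) :=
  g p + (η p).smulRight (η p)

/-- The vector field `θ^♯` dual to `θ`: the image of `θ` under the inverse of `♭`. -/
def sharp (g : BilinForm n M) (η : OneForm n M) (θ : OneForm n M) (p : M) :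
    TangentSpace (𝓡 (n + 1)) p :=
  (flat g η p).inverse (θ p)

/-! ## Weyl screen structures -/

/-- `D g = -2 α ⊗ g`. -/
def IsWeylForm (D : Connection n M) (g : BilinForm n M) (α : OneForm n M) : Prop :=
  ∀ (X Y Z : VF n M) (p : M), D.derivBilin g X Y Z p = -2 * α p (X p) * g p (Y p) (Z p)

/-- `D` is a Weyl structure relative to `(M, c)`. -/
def IsWeylStructure (c : Set (BilinForm n M)) (D : Connection n M) : Prop :=
  D.IsTorsionFree ∧ ∀ g ∈ c, ∃! α : OneForm n M, IsWeylForm D g α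

/-- `D` is a Weyl screen structure relative to `(M, c, S(TM))`: a Weyl structure for which
`S(TM)` is parallel. -/
def IsWeylScreenStructure {ξ : VF n M} (c : Set (BilinForm n M)) (S : ScreenDistribution ξ)
    (D : Connection n M) : Prop :=
  IsWeylStructure c D ∧
    ∀ X Y : VF n M, S.IsSection Y → ∀ p, D.nabla X Y p ∈ S.space p

/-- `Λ` is an Einstein-Weyl function of `D` with respect to `g`:
`Ric^D(X, Y) + Ric^D(Y, X) = Λ g(X, Y)`. -/
def IsEinsteinWeylFunction (D : Connection n M) (g : BilinForm n M) (Λ : SmoothFun n M) : Prop :=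
  ∀ (X Y : VF n M) (p : M), D.ric X Y p + D.ric Y X p = Λ p * g p (X p) (Y p)

/-- `(M, c, S(TM), D)` is an Einstein-Weyl screen structure. -/
def IsEinsteinWeylScreenStructure {ξ : VF n M} (c : Set (BilinForm n M))
    (S : ScreenDistribution ξ) (D : Connection n M) : Prop :=
  IsWeylScreenStructure c S D ∧ ∀ g ∈ c, ∃ Λ : SmoothFun n M, IsEinsteinWeylFunction D g Λ

/-- `Dg` is a connection `D^g`: torsion-free, `g`-compatible, with `D^g_ξ ξ = 0`. -/
structure IsCompatibleConnection (g : BilinForm n M) (ξ : VF n M) (Dg : Connection n M) :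
    Prop where
  torsionFree : Dg.IsTorsionFree
  compatible : ∀ (X Y Z : VF n M) (p : M), Dg.derivBilin g X Y Z p = 0
  geodesic : ∀ p : M, Dg.nabla ξ ξ p = 0

/-- The `1`-form `φ_g` with `D^g_X ξ = φ_g(X) ξ`; it is the `ξ`-component of `D^g_X ξ`. -/
def phi {ξ : VF n M} (S : ScreenDistribution ξ) (Dg : Connection n M) (p : M) :
    TangentSpace (𝓡 (n + 1)) p →L[ℝ] ℝ :=
  (S.η p).comp (Dg.cov ξ p)

/-- The second fundamental form `C` of `S(TM)` in `(M, g)`: for `Y` in `S(TM)`, `C(X, Y)` is the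
`ξ`-component of `D^g_X Y`. -/
def screenForm {ξ : VF n M} (S : ScreenDistribution ξ) (Dg : Connection n M) (X Y : VF n M)
    (p : M) : ℝ :=
  S.η p (Dg.nabla X Y p)

/-- `D` is given by
`D_X Y = D^g_X Y + θ(X) Y + θ(Y) X - g(X, Y) θ^♯ - σ(X, Y) ξ`
with `θ` a horizontal `1`-form and `σ` the symmetric tensor field with `σ(ξ, ξ) = 0` and
`σ(X, Y) = C(X, Y) + η(X) θ(Y)` for `X` in `TM`, `Y` in `S(TM)`. -/
structure IsGivenBy {ξ : VF n M} (S : ScreenDistribution ξ) (D : Connection n M)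
    (g : BilinForm n M) (Dg : Connection n M) (θ : OneForm n M) (σ : BilinForm n M) : Prop where
  horizontal : ∀ p : M, θ p (ξ p) = 0
  symm : ∀ (p : M) (v w : TangentSpace (𝓡 (n + 1)) p), σ p v w = σ p w v
  radical : ∀ p : M, σ p (ξ p) (ξ p) = 0
  screen : ∀ X Y : VF n M, S.IsSection Y → ∀ p : M,
    σ p (X p) (Y p) = screenForm S Dg X Y p + S.η p (X p) * θ p (Y p)
  formula : ∀ (X Y : VF n M) (p : M),
    D.nabla X Y p = Dg.nabla X Y p + θ p (X p) • Y p + θ p (Y p) • X p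
      - g p (X p) (Y p) • sharp g S.η θ p - σ p (X p) (Y p) • ξ p

/-- The tensor `𝒟(θ)(X, Y)`. -/
def calD {ξ : VF n M} (S : ScreenDistribution ξ) (Dg : Connection n M) (θ : OneForm n M)
    (σ : BilinForm n M) (X Y : VF n M) (p : M) : ℝ :=
  (1 - (n : ℝ)) * (Dg.derivForm θ X Y p + Dg.derivForm θ Y X p - 2 * θ p (X p) * θ p (Y p))
    + (Dg.derivBilin σ X ξ Y p + Dg.derivBilin σ Y ξ X p)
    + (phi S Dg p (X p) * σ p (ξ p) (Y p) + phi S Dg p (Y p) * σ p (ξ p) (X p))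
    - 2 * (Dg.derivBilin σ ξ X Y p + σ p (ξ p) (X p) * σ p (ξ p) (Y p))

/-- The function `Λ̄ = ½ Λ - [(1 - n) |θ^♯|² - δθ + σ(ξ, θ^♯)]`, where `|θ^♯|² = g(θ^♯, θ^♯)` and
`δθ = div θ^♯`, the divergence being taken with `D^g`. -/
def barΛ {ξ : VF n M} (S : ScreenDistribution ξ) (g : BilinForm n M) (Dg : Connection n M)
    (θ : OneForm n M) (σ : BilinForm n M) (Λ : SmoothFun n M) (p : M) : ℝ :=
  (1 / 2) * Λ p
    - ((1 - (n : ℝ)) * g p (sharp g S.η θ p) (sharp g S.η θ p)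
      - Dg.div (sharp g S.η θ) p + σ p (ξ p) (sharp g S.η θ p))

/-- `Ric^g = -dφ_g - ½ 𝒟(θ) + Λ̄ g`. -/
def RicciCondition {ξ : VF n M} (S : ScreenDistribution ξ) (g : BilinForm n M)
    (Dg : Connection n M) (θ : OneForm n M) (σ : BilinForm n M) (Λ : SmoothFun n M) : Prop :=
  ∀ (X Y : VF n M) (p : M),
    Dg.ric X Y p = -extD (phi S Dg) X Y p - (1 / 2) * calD S Dg θ σ X Y p
      + barΛ S g Dg θ σ Λ p * g p (X p) (Y p)

end

end LightlikeWeyl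

namespace LightlikeWeyl

open scoped Topology
open Bundle

noncomputable section

set_option linter.unusedSectionVars false

variable {n : ℕ} {M : Type*} [TopologicalSpace M] [ChartedSpace (E n) M]
  [IsManifold (𝓡 (n + 1)) ∞ M]

/-! Total geodesy makes $\xi$ act on $g$ by brackets alone, so the Weyl form $\alpha$ of a
torsion-free $D$ kills $\xi$ (`IsWeylForm.apply_radical_eq_zero`). A Koszul argument then fixes
$D-D^g$ modulo $\xi$, and the tensor $S$ simply records the remaining $\xi$-component; the side
conditions on $S$ express $D_\xi\xi=0$ and the parallelism of the screen (`IsWeylForm.isGivenBy`). A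
connection $D^g$ exists because $D$ can be corrected by $\alpha$ (`weylConnection`). Conversely,
formula (1) visibly yields a torsion-free connection with Weyl form $\theta$ and parallel screen,
and the Weyl form is unique since $g\ne0$ when $n\ge1$.

For the curvature, `IsGivenBy.ric_eq` computes $\mathrm{Ric}^D-\mathrm{Ric}^g$ as a trace of the
change of curvature. Symmetrizing it expresses the Einstein-Weyl equation through the symmetric part
of $\mathrm{Ric}^g$. The skew part is always $-d\varphi_g$ (`ric_sub_ric`): by the Bianchi identity
it is half the trace of $R(X,Y)$, which is $g$-skew and so has trace only along $\xi$. The two parts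
together are exactly equation (2). -/

/-! ## Smooth sections -/

/-- Every tangent vector extends to a global smooth vector field which near its base point is the
constant extension in the preferred trivialization. -/
theorem exists_vf_eventuallyEq_extend [T2Space M] {p : M} (v : TangentSpace (𝓡 (n + 1)) p) :
    ∃ Y : VF n M, ∀ᶠ q in 𝓝 p, Y q = FiberBundle.extend (E n) v q := by
  obtain ⟨s, hs, hsm⟩ := FiberBundle.exists_contMDiffOn_extend (k := ∞) (𝓡 (n + 1)) (E n) v
  obtain ⟨f, -, hf⟩ := (SmoothBumpFunction.nhds_basis_tsupport (I := 𝓡 (n + 1)) p).mem_iff.1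
    (interior_mem_nhds.2 hs)
  refine ⟨⟨_, ContMDiffOn.smul_section_of_tsupport f.contMDiff.contMDiffOn isOpen_interior hf
    (hsm.mono interior_subset)⟩, ?_⟩
  filter_upwards [f.eventuallyEq_one] with q hq
  change f q • FiberBundle.extend (E n) v q = _
  simp [hq]

theorem exists_vf_eq [T2Space M] {p : M} (v : TangentSpace (𝓡 (n + 1)) p) :
    ∃ Y : VF n M, Y p = v := by
  obtain ⟨Y, hY⟩ := exists_vf_eventuallyEq_extend v
  exact ⟨Y, by simpa using hY.self_of_nhds⟩

/-- In a basis of the finite-dimensional `V`, the map is a finite sum of fixed coordinate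
functionals tensored with the values on basis vectors. -/
theorem contMDiffAt_clm_of_apply {V F : Type*} [NormedAddCommGroup V] [NormedSpace ℝ V]
    [FiniteDimensional ℝ V] [NormedAddCommGroup F] [NormedSpace ℝ F] {f : M → V →L[ℝ] F} {p : M}
    (h : ∀ v, ContMDiffAt (𝓡 (n + 1)) 𝓘(ℝ, F) ∞ (fun q ↦ f q v) p) :
    ContMDiffAt (𝓡 (n + 1)) 𝓘(ℝ, V →L[ℝ] F) ∞ f p := by
  let b := Module.finBasis ℝ V
  have hf : f = fun q ↦ ∑ i, ContinuousLinearMap.smulRightL ℝ V F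
      (LinearMap.toContinuousLinearMap (b.coord i)) (f q (b i)) := by
    funext q
    ext v
    conv_lhs => rw [← b.sum_repr v]
    simp [map_sum, -Module.Basis.sum_repr]
  rw [hf]
  exact contMDiffAt_finsetSum fun i _ ↦
    (ContinuousLinearMap.contMDiff _).contMDiffAt.comp p (h (b i))

/-- A field of linear maps on the tangent bundle is smooth if it maps smooth vector fields to
smooth sections. -/
theorem contMDiff_hom_of_apply [T2Space M] {F : Type*} [NormedAddCommGroup F] [NormedSpace ℝ F]
    {W : M → Type*} [TopologicalSpace (TotalSpace F W)] [∀ x, AddCommGroup (W x)]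
    [∀ x, Module ℝ (W x)] [∀ x, TopologicalSpace (W x)] [∀ x, IsTopologicalAddGroup (W x)]
    [∀ x, ContinuousSMul ℝ (W x)] [FiberBundle F W] [VectorBundle ℝ F W]
    (φ : ∀ p : M, TangentSpace (𝓡 (n + 1)) p →L[ℝ] W p)
    (h : ∀ Y : VF n M, ContMDiff (𝓡 (n + 1)) ((𝓡 (n + 1)).prod 𝓘(ℝ, F)) ∞
      (fun p ↦ TotalSpace.mk' F p (φ p (Y p)))) :
    ContMDiff (𝓡 (n + 1)) ((𝓡 (n + 1)).prod 𝓘(ℝ, E n →L[ℝ] F)) ∞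
      (fun p ↦ TotalSpace.mk' (E n →L[ℝ] F)
        (E := fun p : M ↦ TangentSpace (𝓡 (n + 1)) p →L[ℝ] W p) p (φ p)) := by
  intro p
  refine (contMDiffAt_hom_bundle _).2 ⟨contMDiffAt_id, contMDiffAt_clm_of_apply fun w ↦ ?_⟩
  have hp := FiberBundle.mem_baseSet_trivializationAt' (F := E n)
    (E := fun p : M ↦ TangentSpace (𝓡 (n + 1)) p) p
  have hpW := FiberBundle.mem_baseSet_trivializationAt' (F := F) (E := W) p
  let t := trivializationAt (E n) (fun p : M ↦ TangentSpace (𝓡 (n + 1)) p) p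
  obtain ⟨Y, hY⟩ := exists_vf_eventuallyEq_extend (t.symm p w)
  -- Near `p` the field `Y` is constant, equal to `w`, in the trivialization, so applying the
  -- coordinate matrix of `φ` to `w` gives the coordinates of `φ (Y)`.
  refine ((contMDiffAt_section _).1 (h Y p)).congr_of_eventuallyEq ?_
  filter_upwards [hY, t.open_baseSet.mem_nhds hp,
    (trivializationAt F W p).open_baseSet.mem_nhds hpW] with q hq hqt hqW
  have : Y q = t.symm q w := by
    rw [hq, FiberBundle.extend]
    simp [t, t.apply_mk_symm hp]
  rw [ContinuousLinearMap.inCoordinates_eq hqt hqW, this]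
  simp [t]

/-- The smooth `1`-form with given smooth values on vector fields. -/
def OneForm.mk' [T2Space M] (α : ∀ p : M, TangentSpace (𝓡 (n + 1)) p →L[ℝ] ℝ)
    (h : ∀ Y : VF n M, ContMDiff (𝓡 (n + 1)) 𝓘(ℝ, ℝ) ∞ fun p ↦ α p (Y p)) : OneForm n M :=
  ⟨α, contMDiff_hom_of_apply α fun Y p ↦ (contMDiffAt_section _).2 (h Y p)⟩

/-- The smooth `(0,2)`-tensor field with given smooth values on vector fields. -/
def BilinForm.mk' [T2Space M]
    (σ : ∀ p : M, TangentSpace (𝓡 (n + 1)) p →L[ℝ] TangentSpace (𝓡 (n + 1)) p →L[ℝ] ℝ)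
    (h : ∀ Y Z : VF n M, ContMDiff (𝓡 (n + 1)) 𝓘(ℝ, ℝ) ∞ fun p ↦ σ p (Y p) (Z p)) :
    BilinForm n M :=
  ⟨σ, contMDiff_hom_of_apply σ fun Y ↦ (OneForm.mk' (fun p ↦ σ p (Y p)) (h Y)).contMDiff⟩

theorem OneForm.contMDiff_apply (α : OneForm n M) (Y : VF n M) :
    ContMDiff (𝓡 (n + 1)) 𝓘(ℝ, ℝ) ∞ fun p ↦ α p (Y p) := fun p ↦
  (contMDiffAt_section (E := Bundle.Trivial M ℝ) _).1
    ((α.contMDiff.clm_bundle_apply (E₂ := Bundle.Trivial M ℝ) Y.contMDiff) p)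

theorem BilinForm.contMDiff_apply (σ : BilinForm n M) (Y Z : VF n M) :
    ContMDiff (𝓡 (n + 1)) 𝓘(ℝ, ℝ) ∞ fun p ↦ σ p (Y p) (Z p) := fun p ↦
  (contMDiffAt_section (E := Bundle.Trivial M ℝ) _).1
    ((σ.contMDiff.clm_bundle_apply₂ (E₃ := Bundle.Trivial M ℝ) Y.contMDiff Z.contMDiff) p)

/-- The inverse of a smooth field of isomorphisms maps smooth sections to smooth vector fields. -/
theorem contMDiff_symm_apply {F : Type*} [NormedAddCommGroup F] [NormedSpace ℝ F]
    {W : M → Type*} [TopologicalSpace (TotalSpace F W)] [∀ x, AddCommGroup (W x)]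
    [∀ x, Module ℝ (W x)] [∀ x, TopologicalSpace (W x)] [∀ x, IsTopologicalAddGroup (W x)]
    [∀ x, ContinuousSMul ℝ (W x)] [FiberBundle F W] [VectorBundle ℝ F W]
    (e : ∀ p : M, TangentSpace (𝓡 (n + 1)) p ≃L[ℝ] W p)
    (he : ContMDiff (𝓡 (n + 1)) ((𝓡 (n + 1)).prod 𝓘(ℝ, E n →L[ℝ] F)) ∞
      (fun p ↦ TotalSpace.mk' (E n →L[ℝ] F)
        (E := fun p : M ↦ TangentSpace (𝓡 (n + 1)) p →L[ℝ] W p) p (e p).toContinuousLinearMap))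
    {s : ∀ p, W p}
    (hs : ContMDiff (𝓡 (n + 1)) ((𝓡 (n + 1)).prod 𝓘(ℝ, F)) ∞ (fun p ↦ TotalSpace.mk' F p (s p))) :
    ContMDiff (𝓡 (n + 1)) ((𝓡 (n + 1)).prod 𝓘(ℝ, E n)) ∞
      (fun p ↦ TotalSpace.mk' (E n) p ((e p).symm (s p))) := by
  intro p
  refine (contMDiffAt_section _).2 ?_
  have hp := FiberBundle.mem_baseSet_trivializationAt' (F := E n)
    (E := fun p : M ↦ TangentSpace (𝓡 (n + 1)) p) p
  have hpW := FiberBundle.mem_baseSet_trivializationAt' (F := F) (E := W) p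
  let t := trivializationAt (E n) (fun p : M ↦ TangentSpace (𝓡 (n + 1)) p) p
  let u := trivializationAt F W p
  have hA := ((contMDiffAt_hom_bundle _).1 (he p)).2
  have hs' := (contMDiffAt_section _).1 (hs p)
  have key : ∀ q (hq : q ∈ t.baseSet) (hqW : q ∈ u.baseSet),
      ContinuousLinearMap.inCoordinates (E n) (fun p : M ↦ TangentSpace (𝓡 (n + 1)) p) F W p q p q
        (e q).toContinuousLinearMap =
      (((t.continuousLinearEquivAt ℝ q hq).symm.trans ((e q).trans
        (u.continuousLinearEquivAt ℝ q hqW))) : E n →L[ℝ] F) := by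
    intro q hq hqW
    rw [ContinuousLinearMap.inCoordinates_eq hq hqW]
    rfl
  -- Inversion of continuous linear maps is smooth at an isomorphism, and by `key` the coordinate
  -- matrix at `p` is one.
  have hinv : ContMDiffAt (𝓡 (n + 1)) 𝓘(ℝ, F →L[ℝ] E n) ∞ (fun q ↦ ContinuousLinearMap.inverse
      (ContinuousLinearMap.inCoordinates (E n) (fun p : M ↦ TangentSpace (𝓡 (n + 1)) p) F W p q p q
        (e q).toContinuousLinearMap)) p := by
    refine ContMDiffAt.comp p (g := ContinuousLinearMap.inverse) ?_ hA
    refine ContDiffAt.contMDiffAt ?_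
    simp only [key p hp hpW]
    exact contDiffAt_map_inverse _
  refine (hinv.clm_apply hs').congr_of_eventuallyEq ?_
  filter_upwards [t.open_baseSet.mem_nhds hp, u.open_baseSet.mem_nhds hpW] with q hq hqW
  rw [key q hq hqW, ContinuousLinearMap.inverse_equiv]
  have hsq : u.symm q (u ⟨q, s q⟩).2 = s q := u.symm_apply_apply_mk hqW (s q)
  change (t ⟨q, (e q).symm (s q)⟩).2 =
    (t ⟨q, (e q).symm (u.symm q (u ⟨q, s q⟩).2)⟩).2
  rw [hsq]

/-- `D_X Y` as a smooth vector field. -/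
def Connection.nablaVF (D : Connection n M) (X Y : VF n M) : VF n M :=
  ⟨D.nabla X Y, by
    have hY : ContMDiffOn (𝓡 (n + 1)) ((𝓡 (n + 1)).prod 𝓘(ℝ, E n)) (∞ + 1)
      (fun q ↦ Bundle.TotalSpace.mk' (E n) q (Y q)) Set.univ := Y.contMDiff.contMDiffOn
    exact (contMDiffOn_univ.1 (D.smooth.contMDiff.contMDiff hY)).clm_bundle_apply X.contMDiff⟩

/-- `[X, Y]` as a smooth vector field. -/
def bracketVF (X Y : VF n M) : VF n M :=
  ⟨bracket X Y, by
    have : IsManifold (𝓡 (n + 1)) (((⊤ : ℕ∞) : WithTop ℕ∞) + 1) M := ‹_›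
    have : IsManifold (𝓡 (n + 1)) (minSmoothness ℝ 2) M :=
      IsManifold.of_le (n := ∞) (by simpa using ENat.LEInfty.out)
    exact fun p ↦ ContMDiffAt.mlieBracket_vectorField (m := ⊤) (n := ⊤)
      (X.contMDiff p) (Y.contMDiff p) (by simp)⟩

/-- `f • X` as a smooth vector field. -/
def smulVF (f : M → ℝ) (hf : ContMDiff (𝓡 (n + 1)) 𝓘(ℝ, ℝ) ∞ f) (X : VF n M) : VF n M :=
  ⟨f • (X : ∀ p : M, TangentSpace (𝓡 (n + 1)) p), hf.smul_section X.contMDiff⟩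

@[simp] theorem Connection.nablaVF_coe (D : Connection n M) (X Y : VF n M) :
    (D.nablaVF X Y : ∀ p : M, TangentSpace (𝓡 (n + 1)) p) = D.nabla X Y := rfl

@[simp] theorem bracketVF_coe (X Y : VF n M) :
    (bracketVF X Y : ∀ p : M, TangentSpace (𝓡 (n + 1)) p) = bracket X Y := rfl

@[simp] theorem smulVF_coe {f : M → ℝ} (hf : ContMDiff (𝓡 (n + 1)) 𝓘(ℝ, ℝ) ∞ f) (X : VF n M) :
    (smulVF f hf X : ∀ p : M, TangentSpace (𝓡 (n + 1)) p) =
      f • (X : ∀ p : M, TangentSpace (𝓡 (n + 1)) p) := rfl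

/-! ## Calculus -/

theorem mdiff_of_contMDiff {f : M → ℝ} (hf : ContMDiff (𝓡 (n + 1)) 𝓘(ℝ, ℝ) ∞ f) (p : M) :
    MDifferentiableAt (𝓡 (n + 1)) 𝓘(ℝ, ℝ) f p := (hf p).mdifferentiableAt (by simp)

theorem dirD_add {f g : M → ℝ} {p : M} (hf : MDifferentiableAt (𝓡 (n + 1)) 𝓘(ℝ, ℝ) f p)
    (hg : MDifferentiableAt (𝓡 (n + 1)) 𝓘(ℝ, ℝ) g p) (v : TangentSpace (𝓡 (n + 1)) p) :
    dirD (fun q ↦ f q + g q) p v = dirD f p v + dirD g p v :=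
  congr($(mvfderiv_add hf hg) v)

theorem dirD_mul {f g : M → ℝ} {p : M} (hf : MDifferentiableAt (𝓡 (n + 1)) 𝓘(ℝ, ℝ) f p)
    (hg : MDifferentiableAt (𝓡 (n + 1)) 𝓘(ℝ, ℝ) g p) (v : TangentSpace (𝓡 (n + 1)) p) :
    dirD (fun q ↦ f q * g q) p v = f p * dirD g p v + g p * dirD f p v :=
  congr($(mvfderiv_mul hf hg) v)

theorem dirD_const (c : ℝ) (p : M) (v : TangentSpace (𝓡 (n + 1)) p) :
    dirD (fun _ : M ↦ c) p v = 0 :=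
  congr($(mvfderiv_const c) v)

theorem bracket_smul_right {f : M → ℝ} {p : M} (hf : MDifferentiableAt (𝓡 (n + 1)) 𝓘(ℝ, ℝ) f p)
    (X Z : VF n M) :
    bracket X (f • (Z : ∀ p : M, TangentSpace (𝓡 (n + 1)) p)) p =
      dirD f p (X p) • Z p + f p • bracket X Z p :=
  VectorField.mlieBracket_smul_right hf Z.mdifferentiableAt

theorem bracket_swap (X Y : VF n M) (p : M) : bracket X Y p = -bracket Y X p :=
  VectorField.mlieBracket_swap_apply

theorem bracket_leibniz (X Y Z : VF n M) (p : M) :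
    bracket X (bracket Y Z) p = bracket (bracket X Y) Z p + bracket Y (bracket X Z) p := by
  have : IsManifold (𝓡 (n + 1)) (minSmoothness ℝ 3) M :=
    IsManifold.of_le (n := ∞) (by simpa using ENat.LEInfty.out)
  have h (X : VF n M) := (X.contMDiff p).of_le (m := minSmoothness ℝ 2)
    (by simpa using ENat.LEInfty.out)
  exact VectorField.leibniz_identity_mlieBracket_apply (h X) (h Y) (h Z)

/-- The identity $X\cdot f=\eta([X,f\xi])-f\,\eta([X,\xi])$ reduces smoothness of a derivative to
smoothness of brackets. -/
theorem contMDiff_dirD (ξ : VF n M) (η : OneForm n M) (hη : ∀ p, η p (ξ p) = 1) {f : M → ℝ}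
    (hf : ContMDiff (𝓡 (n + 1)) 𝓘(ℝ, ℝ) ∞ f) (X : VF n M) :
    ContMDiff (𝓡 (n + 1)) 𝓘(ℝ, ℝ) ∞ fun p ↦ dirD f p (X p) := by
  have h : (fun p ↦ dirD f p (X p)) = fun p ↦ η p (bracketVF X (smulVF f hf ξ) p) -
      f p * η p (bracketVF X ξ p) := by
    funext p
    simp [bracket_smul_right (mdiff_of_contMDiff hf p), hη]
  rw [h]
  exact (η.contMDiff_apply _).sub (hf.mul (η.contMDiff_apply _))

/-- The Lie bracket acts on functions as a commutator. -/
theorem dirD_bracket (ξ : VF n M) (η : OneForm n M) (hη : ∀ p, η p (ξ p) = 1) {f : M → ℝ}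
    (hf : ContMDiff (𝓡 (n + 1)) 𝓘(ℝ, ℝ) ∞ f) (X Y : VF n M) (p : M) :
    dirD f p (bracket X Y p) = dirD (fun q ↦ dirD f q (Y q)) p (X p) -
      dirD (fun q ↦ dirD f q (X q)) p (Y p) := by
  have hfd := mdiff_of_contMDiff hf p
  have key : ∀ X Y : VF n M, bracket X (bracket Y (smulVF f hf ξ)) p =
      dirD (fun q ↦ dirD f q (Y q)) p (X p) • ξ p + dirD f p (Y p) • bracket X ξ p +
        (dirD f p (X p) • bracket Y ξ p + f p • bracket X (bracket Y ξ) p) := by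
    intro X Y
    have hY := contMDiff_dirD ξ η hη hf Y
    have : bracket Y (smulVF f hf ξ) = (smulVF _ hY ξ + smulVF f hf (bracketVF Y ξ) : VF n M) := by
      funext q
      exact bracket_smul_right (mdiff_of_contMDiff hf q) Y ξ
    rw [this]
    have h2 : bracket X (smulVF _ hY ξ + smulVF f hf (bracketVF Y ξ) : VF n M) p =
      bracket X (smulVF _ hY ξ) p + bracket X (smulVF f hf (bracketVF Y ξ)) p :=
        VectorField.mlieBracket_add_right (smulVF _ hY ξ).mdifferentiableAt
          (smulVF f hf (bracketVF Y ξ)).mdifferentiableAt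
    rw [h2, smulVF_coe, smulVF_coe, bracket_smul_right (mdiff_of_contMDiff hY p),
      bracket_smul_right hfd]
    rfl
  -- The claim is the $\eta$-component of the Jacobi identity for $X,Y,f\xi$: the first-order
  -- products are symmetric in $X,Y$, and the terms in $f$ cancel by the Jacobi identity for
  -- $X,Y,\xi$.
  have h := bracket_leibniz X Y (smulVF f hf ξ) p
  have h3 := bracket_smul_right hfd (bracketVF X Y) ξ
  rw [key, key] at h
  simp only [smulVF_coe, bracketVF_coe] at h h3
  rw [h3] at h
  have h4 := congr(η p $h)
  have h5 := congr(η p $(bracket_leibniz X Y ξ p))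
  simp only [map_add, map_smul, hη, smul_eq_mul] at h4 h5
  rw [h5] at h4
  linarith

namespace Connection

variable (D : Connection n M)

theorem nabla_add (X Y Z : VF n M) (p : M) :
    D.nabla X (Y + Z : VF n M) p = D.nabla X Y p + D.nabla X Z p :=
  congr($(D.cov.isCovariantDerivativeOnUniv.add Y.mdifferentiableAt Z.mdifferentiableAt) (X p))

theorem nabla_smul {f : M → ℝ} (hf : ContMDiff (𝓡 (n + 1)) 𝓘(ℝ, ℝ) ∞ f) (X Y : VF n M) (p : M) :
    D.nabla X (smulVF f hf Y) p = f p • D.nabla X Y p + dirD f p (X p) • Y p :=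
  congr($(D.cov.isCovariantDerivativeOnUniv.leibniz Y.mdifferentiableAt
    (mdiff_of_contMDiff hf p)) (X p))

theorem nabla_sub (X Y Z : VF n M) (p : M) :
    D.nabla X (Y - Z : VF n M) p = D.nabla X Y p - D.nabla X Z p := by
  have h := D.nabla_add X (Y - Z) Z p
  rw [sub_add_cancel] at h
  exact eq_sub_of_add_eq h.symm

end Connection

/-! ## Linear algebra -/

instance finiteDimensional_tangentSpace (p : M) :
    FiniteDimensional ℝ (TangentSpace (𝓡 (n + 1)) p) :=
  inferInstanceAs (FiniteDimensional ℝ (E n))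

instance t2Space_tangentSpace (p : M) : T2Space (TangentSpace (𝓡 (n + 1)) p) :=
  inferInstanceAs (T2Space (E n))

theorem finrank_tangentSpace (p : M) :
    Module.finrank ℝ (TangentSpace (𝓡 (n + 1)) p) = n + 1 :=
  (finrank_euclideanSpace_fin : Module.finrank ℝ (E n) = n + 1)

/-- An endomorphism that is skew for a nondegenerate bilinear form is trace-free. -/
theorem trace_eq_zero_of_skew {V : Type*} [AddCommGroup V] [Module ℝ V] [FiniteDimensional ℝ V]
    (B : V →ₗ[ℝ] Module.Dual ℝ V) (hB : Function.Injective B) (T : V →ₗ[ℝ] V)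
    (hT : ∀ v w, B (T v) w = -B v (T w)) : LinearMap.trace ℝ V T = 0 := by
  let e : V ≃ₗ[ℝ] Module.Dual ℝ V :=
    LinearEquiv.ofInjectiveOfFinrankEq B hB Subspace.dual_finrank_eq.symm
  -- Skewness says that `B` conjugates `T` to minus its transpose, so the trace equals its own
  -- negative.
  have h : e.conj T = -Module.Dual.transpose T := by
    ext φ w
    obtain ⟨v, rfl⟩ := e.surjective φ
    have : e.conj T (e v) = e (T v) := by simp [LinearEquiv.conj_apply]
    rw [this]
    exact hT v w
  have h2 := LinearMap.trace_conj' T e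
  have h3 := map_neg (LinearMap.trace ℝ (Module.Dual ℝ V)) (Module.Dual.transpose T)
  rw [h, h3, LinearMap.trace_transpose'] at h2
  linarith

/-! ### The musical isomorphism of a lightlike metric -/

section Sharp

variable {g : BilinForm n M} {ξ : VF n M}

theorem IsLightlike.apply_radical (hg : IsLightlike g ξ) (p : M)
    (v : TangentSpace (𝓡 (n + 1)) p) : g p (ξ p) v = 0 :=
  (hg.radical p (ξ p)).2 ⟨1, by simp⟩ v

theorem IsLightlike.apply_radical' (hg : IsLightlike g ξ) (p : M)
    (v : TangentSpace (𝓡 (n + 1)) p) : g p v (ξ p) = 0 := by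
  rw [hg.symm, hg.apply_radical]

theorem flat_apply (g : BilinForm n M) (η : OneForm n M) (p : M)
    (v w : TangentSpace (𝓡 (n + 1)) p) : flat g η p v w = g p v w + η p v * η p w := by
  simp [flat]

variable (S : ScreenDistribution ξ)

/-- Pairing $v^\flat=0$ with $\xi$ gives $\eta(v)=0$; then $v$ lies in the radical, and a multiple
of $\xi$ killed by $\eta$ is zero. -/
theorem flat_injective (hg : IsLightlike g ξ) (p : M) : Function.Injective (flat g S.η p) := by
  refine (injective_iff_map_eq_zero _).2 fun v hv ↦ ?_
  have h (w) : g p v w + S.η p v * S.η p w = 0 := by rw [← flat_apply, hv]; rfl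
  have hη : S.η p v = 0 := by simpa [hg.apply_radical', S.η_ξ] using h (ξ p)
  obtain ⟨a, rfl⟩ := (hg.radical p v).1 fun w ↦ by simpa [hη] using h w
  rw [map_smul, S.η_ξ, smul_eq_mul, mul_one] at hη
  simp [hη]

/-- `♭` as an isomorphism. -/
def flatEquiv (hg : IsLightlike g ξ) (p : M) :
    TangentSpace (𝓡 (n + 1)) p ≃L[ℝ] (TangentSpace (𝓡 (n + 1)) p →L[ℝ] ℝ) :=
  have : FiniteDimensional ℝ (TangentSpace (𝓡 (n + 1)) p →L[ℝ] ℝ) :=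
    inferInstanceAs (FiniteDimensional ℝ (E n →L[ℝ] ℝ))
  (LinearEquiv.ofInjectiveOfFinrankEq (flat g S.η p).toLinearMap (flat_injective S hg p)
    (((LinearMap.toContinuousLinearMap (𝕜 := ℝ) (E := E n) (F' := ℝ)).finrank_eq.symm.trans
      Subspace.dual_finrank_eq).symm)).toContinuousLinearEquiv

theorem flatEquiv_coe (hg : IsLightlike g ξ) (p : M) :
    (flatEquiv S hg p).toContinuousLinearMap = flat g S.η p := rfl

theorem sharp_eq (hg : IsLightlike g ξ) (θ : OneForm n M) (p : M) :
    sharp g S.η θ p = (flatEquiv S hg p).symm (θ p) := by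
  rw [sharp, ← flatEquiv_coe S hg, ContinuousLinearMap.inverse_equiv]
  rfl

theorem flat_sharp (hg : IsLightlike g ξ) (θ : OneForm n M) (p : M) :
    flat g S.η p (sharp g S.η θ p) = θ p := by
  rw [sharp_eq S hg, ← flatEquiv_coe S hg]
  exact (flatEquiv S hg p).apply_symm_apply _

theorem η_sharp (hg : IsLightlike g ξ) {θ : OneForm n M} {p : M} (hθ : θ p (ξ p) = 0) :
    S.η p (sharp g S.η θ p) = 0 := by
  have h := congr($(flat_sharp S hg θ p) (ξ p))
  rw [flat_apply, hθ, hg.apply_radical', S.η_ξ] at h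
  linarith

/-- For horizontal $\theta$ the $\eta\otimes\eta$ term of $\flat$ drops out, so $\theta^\sharp$ lies
in the screen and represents $\theta$ through $g$ alone. -/
theorem apply_sharp (hg : IsLightlike g ξ) {θ : OneForm n M} {p : M} (hθ : θ p (ξ p) = 0)
    (v : TangentSpace (𝓡 (n + 1)) p) : g p (sharp g S.η θ p) v = θ p v := by
  have h := congr($(flat_sharp S hg θ p) v)
  rwa [flat_apply, η_sharp S hg hθ, zero_mul, add_zero] at h

/-- `θ^♯` as a smooth vector field. -/
def sharpVF [T2Space M] (hg : IsLightlike g ξ) (θ : OneForm n M) : VF n M :=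
  ⟨sharp g S.η θ, by
    have h := contMDiff_symm_apply (flatEquiv S hg)
      (BilinForm.mk' (flat g S.η) fun Y Z ↦ by
        simp only [flat_apply]
        exact (g.contMDiff_apply Y Z).add
          ((S.η.contMDiff_apply Y).mul (S.η.contMDiff_apply Z))).contMDiff θ.contMDiff
    simpa only [← sharp_eq S hg] using h⟩

@[simp] theorem sharpVF_coe [T2Space M] (hg : IsLightlike g ξ) (θ : OneForm n M) :
    (sharpVF S hg θ : ∀ p : M, TangentSpace (𝓡 (n + 1)) p) = sharp g S.η θ := rfl

end Sharp

/-! ## Tensoriality -/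

namespace Connection

variable (D : Connection n M)

/-- This and the next three lemmas turn each covariant derivative into a linear functional of one
chosen slot, so that it can enter a trace over that slot. -/
theorem exists_derivForm_direction (θ : OneForm n M) (Y : VF n M) (p : M) :
    ∃ ψ : TangentSpace (𝓡 (n + 1)) p →L[ℝ] ℝ, ∀ Z : VF n M, ψ (Z p) = D.derivForm θ Z Y p :=
  ⟨mvfderiv (𝓡 (n + 1)) (fun q ↦ θ q (Y q)) p - (θ p).comp (D.cov Y p), fun _ ↦ rfl⟩

theorem exists_derivBilin_direction (σ : BilinForm n M)
    (hσ : ∀ (p : M) (v w : TangentSpace (𝓡 (n + 1)) p), σ p v w = σ p w v) (X Y : VF n M) (p : M) :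
    ∃ ψ : TangentSpace (𝓡 (n + 1)) p →L[ℝ] ℝ, ∀ Z : VF n M, ψ (Z p) = D.derivBilin σ Z X Y p :=
  ⟨mvfderiv (𝓡 (n + 1)) (fun q ↦ σ q (X q) (Y q)) p - (σ p (Y p)).comp (D.cov X p)
    - (σ p (X p)).comp (D.cov Y p), fun Z ↦ by
      rw [derivBilin, hσ p (D.nabla Z X p)]; rfl⟩

theorem exists_derivForm (θ : OneForm n M) (X : VF n M) (p : M) :
    ∃ ψ : TangentSpace (𝓡 (n + 1)) p →L[ℝ] ℝ, ∀ Z : VF n M, ψ (Z p) = D.derivForm θ X Z p := by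
  have hd {Z : ∀ q : M, TangentSpace (𝓡 (n + 1)) q}
      (hZ : MDifferentiableAt (𝓡 (n + 1)) ((𝓡 (n + 1)).prod 𝓘(ℝ, E n))
        (fun q ↦ Bundle.TotalSpace.mk' (E n) q (Z q)) p) :
      MDifferentiableAt (𝓡 (n + 1)) 𝓘(ℝ, ℝ) (fun q ↦ θ q (Z q)) p :=
    (mdifferentiableAt_section (E := Bundle.Trivial M ℝ) (𝓡 (n + 1)) _).1
      (θ.mdifferentiableAt.clm_bundle_apply (E₂ := Bundle.Trivial M ℝ) hZ)
  have hT : TensorialAt (𝓡 (n + 1)) (E n) (fun Z : (∀ q : M, TangentSpace (𝓡 (n + 1)) q) ↦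
      dirD (fun q ↦ θ q (Z q)) p (X p) - θ p (D.cov Z p (X p))) p :=
    { smul := fun {f Z} hf hZ ↦ by
        have h1 : (fun q ↦ θ q ((f • Z) q)) = fun q ↦ f q * θ q (Z q) := by
          funext q; simp
        rw [h1, dirD_mul hf (hd hZ), D.cov.isCovariantDerivativeOnUniv.leibniz hZ hf]
        simp [dirD]
        ring
      add := fun {Z Z'} hZ hZ' ↦ by
        have h1 : (fun q ↦ θ q ((Z + Z') q)) = fun q ↦ θ q (Z q) + θ q (Z' q) := by
          funext q; simp
        rw [h1, dirD_add (hd hZ) (hd hZ'), D.cov.isCovariantDerivativeOnUniv.add hZ hZ']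
        simp
        ring }
  exact ⟨TensorialAt.mkHom _ p hT, fun Z ↦ TensorialAt.mkHom_apply hT Z.mdifferentiableAt⟩

/-- Freezing the slot `Y` makes `σ` a 1-form, whose derivative differs from that of `σ` only by a
term linear in the value of `Z`. -/
theorem exists_derivBilin [T2Space M] (σ : BilinForm n M)
    (hσ : ∀ (p : M) (v w : TangentSpace (𝓡 (n + 1)) p), σ p v w = σ p w v) (X Y : VF n M) (p : M) :
    ∃ ψ : TangentSpace (𝓡 (n + 1)) p →L[ℝ] ℝ, ∀ Z : VF n M, ψ (Z p) = D.derivBilin σ X Z Y p := by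
  obtain ⟨ψ, hψ⟩ := D.exists_derivForm (OneForm.mk' (fun q ↦ σ q (Y q)) (σ.contMDiff_apply Y)) X p
  refine ⟨ψ - σ p (D.nabla X Y p), fun Z ↦ ?_⟩
  rw [sub_apply, hψ]
  simp only [derivForm, derivBilin, hσ _ (Z _), OneForm.mk', ContMDiffSection.coeFn_mk,
    hσ _ _ (Y p)]

theorem curvEnd_apply (X Y Z : VF n M) (p : M) : D.curvEnd X Y p (Z p) = D.curv X Z Y p :=
  TensorialAt.mkHom_apply _ Z.mdifferentiableAt

end Connection

variable {g : BilinForm n M} {ξ : VF n M} {S : ScreenDistribution ξ} {D Dg : Connection n M}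
  {θ : OneForm n M} {σ : BilinForm n M}

/-! ## Compatible connections -/

namespace IsCompatibleConnection

/-- Differentiating $g(\xi,Y)=0$ with $D^gg=0$ puts $D^g_X\xi$ in the radical, and $\eta$ reads off
the factor. -/
theorem cov_radical [T2Space M] (hg : IsLightlike g ξ) (hDg : IsCompatibleConnection g ξ Dg)
    (S : ScreenDistribution ξ) (p : M) (v : TangentSpace (𝓡 (n + 1)) p) :
    Dg.cov ξ p v = phi S Dg p v • ξ p := by
  obtain ⟨X, rfl⟩ := exists_vf_eq v
  obtain ⟨a, ha⟩ := (hg.radical p (Dg.cov ξ p (X p))).1 fun w ↦ by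
    obtain ⟨Y, rfl⟩ := exists_vf_eq w
    have h := hDg.compatible X ξ Y p
    simp only [Connection.derivBilin, hg.apply_radical, dirD_const] at h
    change 0 - g p (Dg.cov ξ p (X p)) (Y p) - 0 = 0 at h
    linarith
  have : phi S Dg p (X p) = a := by simp [phi, ha, S.η_ξ]
  rw [this, ha]

theorem nabla_radical [T2Space M] (hg : IsLightlike g ξ) (hDg : IsCompatibleConnection g ξ Dg)
    (S : ScreenDistribution ξ) (X : ∀ p : M, TangentSpace (𝓡 (n + 1)) p) (p : M) :
    Dg.nabla X ξ p = phi S Dg p (X p) • ξ p := hDg.cov_radical hg S p (X p)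

theorem phi_radical (hDg : IsCompatibleConnection g ξ Dg) (S : ScreenDistribution ξ) (p : M) :
    phi S Dg p (ξ p) = 0 := by
  have h : Dg.cov ξ p (ξ p) = 0 := hDg.geodesic p
  simp [phi, h]

theorem dirD_apply (hDg : IsCompatibleConnection g ξ Dg) (X Y Z : VF n M) (p : M) :
    dirD (fun q ↦ g q (Y q) (Z q)) p (X p) = g p (Dg.nabla X Y p) (Z p) +
      g p (Y p) (Dg.nabla X Z p) := by
  have h := hDg.compatible X Y Z p
  rw [Connection.derivBilin] at h
  linarith

end IsCompatibleConnection

theorem contMDiff_phi (S : ScreenDistribution ξ) (Dg : Connection n M) (X : VF n M) :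
    ContMDiff (𝓡 (n + 1)) 𝓘(ℝ, ℝ) ∞ fun p ↦ phi S Dg p (X p) :=
  S.η.contMDiff_apply (Dg.nablaVF X ξ)

theorem Connection.IsTorsionFree.bracket_eq (h : Dg.IsTorsionFree) (X Y : VF n M) (p : M) :
    bracket X Y p = Dg.nabla X Y p - Dg.nabla Y X p := (h X Y p).symm

/-! ## Change of the curvature -/

/-- The difference tensor `D_X Y - D^g_X Y`. -/
def diffVF [T2Space M] (hg : IsLightlike g ξ) (S : ScreenDistribution ξ) (θ : OneForm n M)
    (σ : BilinForm n M) (X Y : VF n M) : VF n M :=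
  smulVF _ (θ.contMDiff_apply X) Y + smulVF _ (θ.contMDiff_apply Y) X
    - smulVF _ (g.contMDiff_apply X Y) (sharpVF S hg θ) - smulVF _ (σ.contMDiff_apply X Y) ξ

theorem diffVF_apply [T2Space M] (hg : IsLightlike g ξ) (X Y : VF n M) (p : M) :
    diffVF hg S θ σ X Y p = θ p (X p) • Y p + θ p (Y p) • X p
      - g p (X p) (Y p) • sharp g S.η θ p - σ p (X p) (Y p) • ξ p := rfl

theorem IsGivenBy.nabla_eq [T2Space M] (hg : IsLightlike g ξ) (h : IsGivenBy S D g Dg θ σ)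
    (X Y : VF n M) :
    D.nabla X Y = (Dg.nablaVF X Y + diffVF hg S θ σ X Y : VF n M) := by
  funext p
  rw [h.formula]
  change _ = Dg.nabla X Y p + diffVF hg S θ σ X Y p
  rw [diffVF_apply]
  abel

/-- The derivative of the difference tensor. -/
theorem nabla_diffVF [T2Space M] (hg : IsLightlike g ξ) (hDg : IsCompatibleConnection g ξ Dg)
    (X Z Y : VF n M) (p : M) :
    Dg.nabla X (diffVF hg S θ σ Z Y) p =
      (diffVF hg S θ σ (Dg.nablaVF X Z) Y p + diffVF hg S θ σ Z (Dg.nablaVF X Y) p)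
      + (Dg.derivForm θ X Z p • Y p + Dg.derivForm θ X Y p • Z p
        - Dg.derivBilin g X Z Y p • sharp g S.η θ p
        - g p (Z p) (Y p) • Dg.cov (sharp g S.η θ) p (X p)
        - Dg.derivBilin σ X Z Y p • ξ p - (σ p (Z p) (Y p) * phi S Dg p (X p)) • ξ p) := by
  rw [diffVF, Connection.nabla_sub, Connection.nabla_sub, Connection.nabla_add,
    Connection.nabla_smul, Connection.nabla_smul, Connection.nabla_smul, Connection.nabla_smul,
    hDg.nabla_radical hg S]
  simp only [diffVF_apply, Connection.derivForm, Connection.derivBilin, Connection.nablaVF_coe,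
    sharpVF_coe]
  change _ + _ - (g p (Z p) (Y p) • Dg.cov (sharp g S.η θ) p (X p) + _) - _ = _
  module

/-- With $A=D-D^g$ this is the usual
$R^D(X,Z)Y=R^g(X,Z)Y+(D^g_ZA)(X,Y)-(D^g_XA)(Z,Y)+A(Z,A(X,Y))-A(X,A(Z,Y))$; torsion-freeness of $D^g$
absorbs the bracket, and $D^gg=0$ removes the derivatives of $g$. -/
theorem IsGivenBy.curv_eq [T2Space M] (hg : IsLightlike g ξ) (hDg : IsCompatibleConnection g ξ Dg)
    (h : IsGivenBy S D g Dg θ σ) (X Z Y : VF n M) (p : M) :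
    D.curv X Z Y p = Dg.curv X Z Y p
      + (Dg.derivForm θ Z X p • Y p + Dg.derivForm θ Z Y p • X p
        - g p (X p) (Y p) • Dg.cov (sharp g S.η θ) p (Z p)
        - Dg.derivBilin σ Z X Y p • ξ p - (σ p (X p) (Y p) * phi S Dg p (Z p)) • ξ p)
      - (Dg.derivForm θ X Z p • Y p + Dg.derivForm θ X Y p • Z p
        - g p (Z p) (Y p) • Dg.cov (sharp g S.η θ) p (X p)
        - Dg.derivBilin σ X Z Y p • ξ p - (σ p (Z p) (Y p) * phi S Dg p (X p)) • ξ p)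
      + diffVF hg S θ σ Z (diffVF hg S θ σ X Y) p - diffVF hg S θ σ X (diffVF hg S θ σ Z Y) p := by
  have e1 := h.nabla_eq hg (bracketVF X Z) Y
  rw [bracketVF_coe] at e1
  simp only [Connection.curv]
  rw [e1, h.nabla_eq hg Z Y, h.nabla_eq hg X Y, h.nabla_eq hg X, h.nabla_eq hg Z]
  simp only [fun (V W : VF n M) ↦ show (V + W : VF n M) p = V p + W p from rfl,
    Connection.nablaVF_coe, Connection.nabla_add]
  rw [nabla_diffVF hg hDg, nabla_diffVF hg hDg, hDg.compatible, hDg.compatible]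
  simp only [diffVF_apply, ContMDiffSection.coe_add, Pi.add_apply, Connection.nablaVF_coe,
    bracketVF_coe, hDg.torsionFree.bracket_eq, map_add, map_sub, sub_apply,
    map_smul]
  module

attribute [irreducible] diffVF

/-! ## Change of the Ricci curvature -/

theorem trace_clm_smulRight {p : M} (f : TangentSpace (𝓡 (n + 1)) p →L[ℝ] ℝ)
    (v : TangentSpace (𝓡 (n + 1)) p) :
    LinearMap.trace ℝ (TangentSpace (𝓡 (n + 1)) p) (f.smulRight v).toLinearMap = f v :=
  LinearMap.trace_smulRight f.toLinearMap v

theorem trace_clm_id (p : M) :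
    LinearMap.trace ℝ (TangentSpace (𝓡 (n + 1)) p)
      (ContinuousLinearMap.id ℝ (TangentSpace (𝓡 (n + 1)) p)).toLinearMap = n + 1 := by
  rw [ContinuousLinearMap.coe_id, LinearMap.trace_id, finrank_tangentSpace]
  push_cast
  rfl

/-- Metric compatibility applied to $g(\theta^\sharp,Y)=\theta(Y)$. -/
theorem apply_nabla_sharp [T2Space M] (hg : IsLightlike g ξ) (hDg : IsCompatibleConnection g ξ Dg)
    (hθ : ∀ p, θ p (ξ p) = 0) (X Y : VF n M) (p : M) :
    g p (Dg.cov (sharp g S.η θ) p (X p)) (Y p) = Dg.derivForm θ X Y p := by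
  have h := hDg.dirD_apply X (sharpVF S hg θ) Y p
  simp only [sharpVF_coe, apply_sharp S hg (hθ _)] at h
  rw [Connection.derivForm, h]
  change _ = g p (Dg.cov (sharp g S.η θ) p (X p)) (Y p) + _ - _
  ring

-- The change of curvature, seen as an endomorphism in $Z$, is a combination of rank-one maps, the
-- identity, $A(X,\cdot)$ and $D^g\theta^\sharp$, where $A=D-D^g$. All of these have explicit
-- traces, the last one being $\delta^g\theta$.
set_option maxHeartbeats 1000000 in
theorem IsGivenBy.ric_eq [T2Space M] (hg : IsLightlike g ξ) (hDg : IsCompatibleConnection g ξ Dg)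
    (h : IsGivenBy S D g Dg θ σ) (X Y : VF n M) (p : M) :
    D.ric X Y p = Dg.ric X Y p + Dg.derivForm θ Y X p - n * Dg.derivForm θ X Y p
      + Dg.derivBilin σ X ξ Y p + phi S Dg p (X p) * σ p (ξ p) (Y p)
      - Dg.derivBilin σ ξ X Y p - σ p (ξ p) (X p) * σ p (ξ p) (Y p)
      + (n - 1) * (θ p (X p) * θ p (Y p))
      + ((1 - n) * g p (sharp g S.η θ p) (sharp g S.η θ p) - Dg.div (sharp g S.η θ) p
        + σ p (ξ p) (sharp g S.η θ p)) * g p (X p) (Y p) := by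
  obtain ⟨ψ₁, h₁⟩ := Dg.exists_derivForm_direction θ X p
  obtain ⟨ψ₂, h₂⟩ := Dg.exists_derivForm_direction θ Y p
  obtain ⟨ψ₃, h₃⟩ := Dg.exists_derivBilin_direction σ h.symm X Y p
  obtain ⟨ψ₄, h₄⟩ := Dg.exists_derivForm θ X p
  obtain ⟨ψ₅, h₅⟩ := Dg.exists_derivBilin σ h.symm X Y p
  have hnab := apply_nabla_sharp (S := S) hg hDg h.horizontal X Y p
  have hφ := hDg.phi_radical S p
  have hθ := h.horizontal p
  have hσ := h.radical p
  have hgW (v) : g p (sharp g S.η θ p) v = θ p v := apply_sharp S hg hθ v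
  obtain ⟨W, hW⟩ : ∃ W, sharp g S.η θ p = W := ⟨_, rfl⟩
  rw [hW] at hgW ⊢
  have hgW' (v) : g p v W = θ p v := by rw [hg.symm, hgW]
  obtain ⟨a, ha⟩ : ∃ a, diffVF hg S θ σ X Y p = a := ⟨_, rfl⟩
  obtain ⟨I, hI, hIt⟩ : ∃ I : TangentSpace (𝓡 (n + 1)) p →L[ℝ] TangentSpace (𝓡 (n + 1)) p,
      (∀ v, I v = v) ∧
      LinearMap.trace ℝ (TangentSpace (𝓡 (n + 1)) p) I.toLinearMap = n + 1 :=
    ⟨ContinuousLinearMap.id ℝ _, fun _ ↦ rfl, trace_clm_id p⟩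
  -- `Q` is $v\mapsto A(X,v)$. In its trace the contributions of $\theta\otimes X$ and
  -- $g(X,\cdot)\otimes\theta^\sharp$ cancel, both being $\theta(X)$.
  obtain ⟨Q, hQ, hQt⟩ : ∃ Q : TangentSpace (𝓡 (n + 1)) p →L[ℝ] TangentSpace (𝓡 (n + 1)) p,
      (∀ v, Q v = θ p (X p) • v + θ p v • X p - g p (X p) v • W - σ p (X p) v • ξ p) ∧
      LinearMap.trace ℝ (TangentSpace (𝓡 (n + 1)) p) Q.toLinearMap =
        (n + 1) * θ p (X p) - σ p (X p) (ξ p) := by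
    refine ⟨θ p (X p) • I + (θ p).smulRight (X p)
      - (g p (X p)).smulRight W - (σ p (X p)).smulRight (ξ p), fun v ↦ ?_, ?_⟩
    · simp only [add_apply, sub_apply, smul_apply, ContinuousLinearMap.smulRight_apply, hI]
    · simp only [ContinuousLinearMap.toLinearMap_add, ContinuousLinearMap.toLinearMap_sub,
        ContinuousLinearMap.toLinearMap_smul, map_add, map_sub, map_smul, trace_clm_smulRight, hIt,
        hgW', smul_eq_mul]
      ring
  -- The last two groups are $A(Z,a)$ with $a=A(X,Y)$, and $Q(A(Z,Y))$ expanded by linearity of `Q`.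
  have key : D.curvEnd X Y p = Dg.curvEnd X Y p
      + (ψ₁.smulRight (Y p) + ψ₂.smulRight (X p) - g p (X p) (Y p) • Dg.cov (sharp g S.η θ) p
        - ψ₃.smulRight (ξ p) - σ p (X p) (Y p) • (phi S Dg p).smulRight (ξ p))
      - (ψ₄.smulRight (Y p) + Dg.derivForm θ X Y p • I
        - (g p (Y p)).smulRight (Dg.cov (sharp g S.η θ) p (X p)) - ψ₅.smulRight (ξ p)
        - phi S Dg p (X p) • (σ p (Y p)).smulRight (ξ p))
      + ((θ p).smulRight a + θ p a • I - (g p a).smulRight W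
        - (σ p a).smulRight (ξ p))
      - ((θ p).smulRight (Q (Y p)) + θ p (Y p) • Q - (g p (Y p)).smulRight (Q W)
        - (σ p (Y p)).smulRight (Q (ξ p))) := by
    ext v
    obtain ⟨Z, rfl⟩ := exists_vf_eq v
    rw [Connection.curvEnd_apply, h.curv_eq hg hDg]
    have e1 : diffVF hg S θ σ X (diffVF hg S θ σ Z Y) p = Q (diffVF hg S θ σ Z Y p) := by
      rw [diffVF_apply, hQ, hW]
    rw [e1, diffVF_apply hg Z Y, diffVF_apply hg Z (diffVF hg S θ σ X Y), ha, hW]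
    simp only [map_add, map_sub, map_smul, add_apply, sub_apply, smul_apply,
      ContinuousLinearMap.smulRight_apply, hI, h₁, h₂, h₃, h₄, h₅,
      Connection.curvEnd_apply, hg.symm p (Z p), h.symm p (Z p)]
    module
  rw [Connection.ric, key]
  simp only [ContinuousLinearMap.toLinearMap_add, ContinuousLinearMap.toLinearMap_sub,
    ContinuousLinearMap.toLinearMap_smul, map_add, map_sub, map_smul, trace_clm_smulRight,
    hIt, hQt, smul_eq_mul]
  have ha' : a = θ p (X p) • Y p + θ p (Y p) • X p - g p (X p) (Y p) • W
    - σ p (X p) (Y p) • ξ p := by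
    rw [← ha, diffVF_apply, hW]
  rw [hg.symm p (Y p) (Dg.cov _ _ _), hnab, h₁, h₂, h₃, h₄, h₅, ha']
  simp only [hQ, map_add, map_sub, map_smul, hgW', hθ, hφ, hσ, smul_eq_mul, add_apply,
    sub_apply, smul_apply, hg.apply_radical', h.symm p _ (ξ p),
    hg.symm p (Y p) (X p), h.symm p (Y p) (X p), h.symm p (X p) W, h.symm p (Y p) W]
  simp only [Connection.ric, Connection.div]
  ring

/-! ## The skew-symmetric part of the Ricci curvature -/

/-- Written this way, the second derivatives in the cyclic curvature sum cancel and the Bianchi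
identity reduces to the Jacobi identity. -/
theorem Connection.IsTorsionFree.nabla_bracket (h : Dg.IsTorsionFree) (X Y Z : VF n M) (p : M) :
    Dg.nabla (bracket X Y) Z p = bracket (bracket X Y) Z p +
      (Dg.nabla Z (Dg.nabla X Y) p - Dg.nabla Z (Dg.nabla Y X) p) := by
  have e : bracketVF X Y = Dg.nablaVF X Y - Dg.nablaVF Y X :=
    ContMDiffSection.ext fun q ↦ h.bracket_eq X Y q
  have h1 := h (bracketVF X Y) Z p
  rw [sub_eq_iff_eq_add] at h1
  have h2 := Dg.nabla_sub Z (Dg.nablaVF X Y) (Dg.nablaVF Y X) p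
  rw [← e] at h2
  rw [h2] at h1
  exact h1

/-- The first Bianchi identity. -/
theorem Connection.IsTorsionFree.curv_sub_curv (h : Dg.IsTorsionFree) (X Y Z : VF n M) (p : M) :
    Dg.curv X Z Y p - Dg.curv Y Z X p = Dg.curv X Y Z p := by
  simp only [Connection.curv, h.nabla_bracket]
  have h1 := bracket_leibniz X Y Z p
  have h2 := bracket_swap X (bracketVF Y Z) p
  have h3 := bracket_swap Y (bracketVF X Z) p
  rw [bracketVF_coe] at h2 h3
  rw [h2, h3] at h1
  have h4 : bracket (bracket X Y) Z p = bracket (bracket X Z) Y p - bracket (bracket Y Z) X p := by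
    rw [sub_eq_add_neg, h1]
    abel
  rw [h4]
  abel

namespace IsCompatibleConnection

/-- The bracket acts on the function $g(Z,W)$ as a commutator; the mixed terms $g(D^g_XZ,D^g_YW)$
are symmetric in the pair $X,Y$ after summation and cancel. -/
theorem curv_skew (hDg : IsCompatibleConnection g ξ Dg) (S : ScreenDistribution ξ)
    (X Y Z W : VF n M) (p : M) :
    g p (Dg.curv X Y Z p) (W p) = -g p (Z p) (Dg.curv X Y W p) := by
  have h := dirD_bracket ξ S.η S.η_ξ (g.contMDiff_apply Z W) X Y p
  have hd (X Y : VF n M) : dirD (fun q ↦ dirD (fun q ↦ g q (Z q) (W q)) q (Y q)) p (X p) =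
      g p (Dg.nabla X (Dg.nabla Y Z) p) (W p) + g p (Dg.nabla Y Z p) (Dg.nabla X W p) +
        (g p (Dg.nabla X Z p) (Dg.nabla Y W p) + g p (Z p) (Dg.nabla X (Dg.nabla Y W) p)) := by
    simp only [hDg.dirD_apply]
    have h1 := mdiff_of_contMDiff (g.contMDiff_apply (Dg.nablaVF Y Z) W) p
    have h2 := mdiff_of_contMDiff (g.contMDiff_apply Z (Dg.nablaVF Y W)) p
    have h3 := hDg.dirD_apply X (Dg.nablaVF Y Z) W p
    have h4 := hDg.dirD_apply X Z (Dg.nablaVF Y W) p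
    have h5 := dirD_add h1 h2 (X p)
    rw [h3, h4] at h5
    exact h5
  have h0 := hDg.dirD_apply (bracketVF X Y) Z W p
  rw [bracketVF_coe] at h0
  rw [h0, hd, hd] at h
  simp only [Connection.curv, map_sub, sub_apply]
  linarith

/-- On the line bundle spanned by $\xi$ the connection form is $\varphi_g$, and the quadratic terms
in $\varphi_g$ commute; the factor 2 undoes the $\tfrac12$ in `extD`. -/
theorem curv_radical [T2Space M] (hg : IsLightlike g ξ) (hDg : IsCompatibleConnection g ξ Dg)
    (S : ScreenDistribution ξ) (X Y : VF n M) (p : M) :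
    Dg.curv X Y ξ p = (-2 * extD (phi S Dg) X Y p) • ξ p := by
  have hn (Y : VF n M) : Dg.nabla Y ξ = smulVF _ (contMDiff_phi S Dg Y) ξ := by
    funext q
    exact hDg.nabla_radical hg S Y q
  simp only [Connection.curv, extD]
  rw [hn X, hn Y, Connection.nabla_smul, Connection.nabla_smul, hDg.nabla_radical hg S,
    hDg.nabla_radical hg S, hDg.nabla_radical hg S]
  module

/-- By Bianchi the left side is the trace of $T=R(X,Y)$. Its screen part is skew for the
nondegenerate form $\flat$, hence trace-free, leaving only $\eta(T\xi)$. -/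
theorem ric_sub_ric [T2Space M] (hg : IsLightlike g ξ) (hDg : IsCompatibleConnection g ξ Dg)
    (S : ScreenDistribution ξ) (X Y : VF n M) (p : M) :
    Dg.ric X Y p - Dg.ric Y X p = -2 * extD (phi S Dg) X Y p := by
  obtain ⟨T, hT⟩ : ∃ T, T = Dg.curvEnd X Y p - Dg.curvEnd Y X p := ⟨_, rfl⟩
  have hTZ (Z : VF n M) : T (Z p) = Dg.curv X Y Z p := by
    rw [hT, sub_apply, Dg.curvEnd_apply, Dg.curvEnd_apply, hDg.torsionFree.curv_sub_curv]
  -- Removing the $\xi$-component does not affect $g$ but kills the $\eta\otimes\eta$ part of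
  -- $\flat$, so $g$-skewness becomes $\flat$-skewness.
  obtain ⟨T', hT'⟩ : ∃ T', T' = T - ((S.η p).comp T).smulRight (ξ p) := ⟨_, rfl⟩
  have hT'a (v) : T' v = T v - S.η p (T v) • ξ p := by rw [hT']; rfl
  have hη (v) : S.η p (T' v) = 0 := by simp [hT'a, S.η_ξ]
  have hskew (v w) : g p (T' v) w = -g p v (T' w) := by
    obtain ⟨Z, rfl⟩ := exists_vf_eq v
    obtain ⟨W, rfl⟩ := exists_vf_eq w
    simp only [hT'a, hTZ, map_sub, map_smul, sub_apply, smul_apply, hg.apply_radical,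
      hg.apply_radical', hDg.curv_skew S X Y Z W, smul_zero, sub_zero]
  have h0 := trace_eq_zero_of_skew (V := TangentSpace (𝓡 (n + 1)) p)
    { toFun := fun v ↦ (flat g S.η p v).toLinearMap
      map_add' := fun v w ↦ by rw [map_add]; rfl
      map_smul' := fun c v ↦ by rw [map_smul]; rfl }
    (fun v w h ↦ flat_injective S hg p (ContinuousLinearMap.coe_injective h)) T'.toLinearMap
    (fun v w ↦ by
      change flat g S.η p (T' v) w = -flat g S.η p v (T' w)
      rw [flat_apply, flat_apply, hη, hη, hskew]
      ring)
  rw [hT', ContinuousLinearMap.toLinearMap_sub, map_sub, trace_clm_smulRight,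
    ContinuousLinearMap.comp_apply, hTZ, hDg.curv_radical hg S, map_smul, S.η_ξ, hT,
    ContinuousLinearMap.toLinearMap_sub, map_sub] at h0
  rw [Connection.ric, Connection.ric]
  simpa using sub_eq_zero.1 h0

end IsCompatibleConnection

/-! ## Einstein-Weyl functions and the Ricci condition -/

/-- Adding `ric_eq` to its transpose controls the symmetric part of $\mathrm{Ric}^g$, and
`ric_sub_ric` supplies the skew part; the equivalence is linear at each point. -/
theorem IsGivenBy.isEinsteinWeylFunction_iff [T2Space M] (hg : IsLightlike g ξ)
    (hDg : IsCompatibleConnection g ξ Dg) (h : IsGivenBy S D g Dg θ σ) (Λ : SmoothFun n M) :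
    IsEinsteinWeylFunction D g Λ ↔ RicciCondition S g Dg θ σ Λ := by
  refine forall₃_congr fun X Y p ↦ ?_
  have h1 := h.ric_eq hg hDg X Y p
  have h2 := h.ric_eq hg hDg Y X p
  have h3 := hDg.ric_sub_ric hg S X Y p
  have h4 : Dg.derivBilin σ ξ X Y p = Dg.derivBilin σ ξ Y X p := by
    simp only [Connection.derivBilin, h.symm _ (X _), h.symm _ (Dg.nabla ξ X p)]
    ring
  have h5 := hg.symm p (Y p) (X p)
  rw [h1, h2, calD, barΛ, h5, h4]
  constructor <;> intro h6 <;> linarith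

variable {g₀ : BilinForm n M} {α : OneForm n M}

/-! ## The conformal class -/

theorem self_mem_conformalClass (g₀ : BilinForm n M) (ξ : VF n M) : g₀ ∈ conformalClass g₀ ξ :=
  ⟨0, fun p ↦ dirD_const 0 p _, fun p v w ↦ by simp⟩

theorem IsLightlike.of_mem_conformalClass (hg₀ : IsLightlike g₀ ξ) (hg : g ∈ conformalClass g₀ ξ) :
    IsLightlike g ξ := by
  obtain ⟨f, -, hf⟩ := hg
  refine ⟨fun p v w ↦ by rw [hf, hf, hg₀.symm], hg₀.ne_zero, fun p v ↦ ?_⟩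
  rw [← hg₀.radical p v]
  simp [hf, Real.exp_ne_zero]

theorem IsTotallyGeodesic.dirD_radical (hgeo : IsTotallyGeodesic g₀ ξ) (Y Z : VF n M) (p : M) :
    dirD (fun q ↦ g₀ q (Y q) (Z q)) p (ξ p) = g₀ p (bracket ξ Y p) (Z p) +
      g₀ p (Y p) (bracket ξ Z p) := by
  have h := hgeo Y Z p
  rw [secondFundamentalForm] at h
  linarith

/-- The factor $e^{-2f}$ is constant along $\xi$, so the second fundamental form is merely rescaled.
-/
theorem IsTotallyGeodesic.of_mem_conformalClass (hgeo : IsTotallyGeodesic g₀ ξ)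
    (hg : g ∈ conformalClass g₀ ξ) : IsTotallyGeodesic g ξ := by
  obtain ⟨f, hfξ, hf⟩ := hg
  intro Y Z p
  have hexp : ContDiff ℝ ∞ fun t : ℝ ↦ Real.exp (-2 * t) := by fun_prop
  have hfp : MDifferentiableAt (𝓡 (n + 1)) 𝓘(ℝ, ℝ) f p := mdiff_of_contMDiff f.contMDiff p
  have hu : ContMDiff (𝓡 (n + 1)) 𝓘(ℝ, ℝ) ∞ fun p ↦ Real.exp (-2 * f p) :=
    hexp.contMDiff.comp f.contMDiff
  have h0 : dirD (fun p ↦ Real.exp (-2 * f p)) p (ξ p) = 0 := by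
    have h := mvfderiv_comp_apply (I := 𝓘(ℝ, ℝ)) (I' := 𝓡 (n + 1)) (x := p)
      (g := fun t : ℝ ↦ Real.exp (-2 * t)) (f := f)
      ((hexp.contMDiff _).mdifferentiableAt (by simp)) hfp (ξ p)
    have h2 : mfderiv (𝓡 (n + 1)) 𝓘(ℝ, ℝ) f p (ξ p) = 0 := hfξ p
    rw [h2, map_zero] at h
    exact h
  have h1 := dirD_mul (mdiff_of_contMDiff hu p)
    (mdiff_of_contMDiff (g₀.contMDiff_apply Y Z) p) (ξ p)
  rw [h0, hgeo.dirD_radical] at h1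
  simp only [secondFundamentalForm, hf]
  rw [h1]
  ring

/-- If $g_p=0$, the radical would be the whole tangent space, of dimension $n+1\ge2$, yet spanned by
$\xi$. -/
theorem IsLightlike.exists_apply_ne_zero (hn : 1 ≤ n) (hg : IsLightlike g ξ) (p : M) :
    ∃ v w : TangentSpace (𝓡 (n + 1)) p, g p v w ≠ 0 := by
  by_contra! h
  have h1 : Module.finrank ℝ (TangentSpace (𝓡 (n + 1)) p) ≤ 1 :=
    finrank_le_one (ξ p) fun v ↦ by
      obtain ⟨a, ha⟩ := (hg.radical p v).1 (h v)
      exact ⟨a, ha.symm⟩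
  rw [finrank_tangentSpace] at h1
  omega

/-! ## Weyl structures -/

theorem IsWeylForm.dirD_apply (hα : IsWeylForm D g α) (X Y Z : VF n M) (p : M) :
    dirD (fun q ↦ g q (Y q) (Z q)) p (X p) = g p (D.nabla X Y p) (Z p) +
      g p (Y p) (D.nabla X Z p) - 2 * α p (X p) * g p (Y p) (Z p) := by
  have h := hα X Y Z p
  rw [Connection.derivBilin] at h
  linarith

/-- The Weyl form of a torsion-free connection is horizontal. -/
theorem IsWeylForm.apply_radical_eq_zero [T2Space M] (hα : IsWeylForm D g α) (hn : 1 ≤ n)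
    (hg : IsLightlike g ξ) (hgeo : IsTotallyGeodesic g ξ) (hD : D.IsTorsionFree) (p : M) :
    α p (ξ p) = 0 := by
  obtain ⟨v, w, hvw⟩ := hg.exists_apply_ne_zero hn p
  obtain ⟨Y, rfl⟩ := exists_vf_eq v
  obtain ⟨Z, rfl⟩ := exists_vf_eq w
  -- $D_Y\xi$ is radical, so $[\xi,Y]$ and $D_\xi Y$ agree under $g$. Total geodesy then leaves
  -- $\alpha(\xi)g(Y,Z)=0$, with $Y,Z$ chosen so that $g(Y,Z)\neq0$.
  have h0 (Y Z : VF n M) : g p (D.nabla Y ξ p) (Z p) = 0 := by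
    have h := hα.dirD_apply Y ξ Z p
    simp only [hg.apply_radical, dirD_const] at h
    linarith
  have h1 := hα.dirD_apply ξ Y Z p
  have h3 := h0 Y Z
  have h4 := h0 Z Y
  rw [hg.symm] at h4
  rw [hgeo.dirD_radical, hD.bracket_eq, hD.bracket_eq, map_sub, map_sub, sub_apply, h3, h4] at h1
  have h2 : α p (ξ p) * g p (Y p) (Z p) = 0 := by linarith
  exact (mul_eq_zero.1 h2).resolve_right hvw

/-- The Koszul-type formula for the difference of `D` and `D^g`. -/
theorem IsWeylForm.apply_nabla_sub (hα : IsWeylForm D g α) (hg : IsLightlike g ξ)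
    (hD : D.IsTorsionFree) (hDg : IsCompatibleConnection g ξ Dg) (X Y Z : VF n M) (p : M) :
    g p (D.nabla X Y p) (Z p) = g p (Dg.nabla X Y p) (Z p) + α p (X p) * g p (Y p) (Z p)
      + α p (Y p) * g p (X p) (Z p) - α p (Z p) * g p (X p) (Y p) := by
  have key (X Y Z : VF n M) : g p (D.nabla X Y p) (Z p) + g p (D.nabla X Z p) (Y p)
      = g p (Dg.nabla X Y p) (Z p) + g p (Dg.nabla X Z p) (Y p) +
        2 * α p (X p) * g p (Y p) (Z p) := by
    have h1 := hα.dirD_apply X Y Z p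
    rw [hDg.dirD_apply, hg.symm p (Y p) (D.nabla X Z p), hg.symm p (Y p) (Dg.nabla X Z p)] at h1
    linarith
  have hs (X Y Z : VF n M) : g p (D.nabla X Y p) (Z p) - g p (D.nabla Y X p) (Z p) =
      g p (Dg.nabla X Y p) (Z p) - g p (Dg.nabla Y X p) (Z p) := by
    have h := (hD X Y p).trans (hDg.torsionFree X Y p).symm
    simpa using congr(g p $h (Z p))
  -- Koszul's combination: `h1 + h2 - h3`, with the symmetry of the difference tensor, isolates
  -- twice the wanted term.
  have h1 := key X Y Z
  have h2 := key Y Z X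
  have h3 := key Z X Y
  have h4 := hs X Y Z
  have h5 := hs X Z Y
  have h6 := hs Y Z X
  rw [hg.symm p (Z p) (X p)] at h2
  linarith

/-- A vector annihilated by `g` and `η` vanishes. -/
theorem IsLightlike.eq_of_apply_eq [T2Space M] (hg : IsLightlike g ξ) (S : ScreenDistribution ξ)
    {p : M} {v w : TangentSpace (𝓡 (n + 1)) p} (h : ∀ Z : VF n M, g p v (Z p) = g p w (Z p))
    (hη : S.η p v = S.η p w) : v = w := by
  apply flat_injective S hg p
  ext z
  obtain ⟨Z, rfl⟩ := exists_vf_eq z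
  rw [flat_apply, flat_apply, h, hη]

/-- The `ξ`-component of the difference tensor of two connections, corrected by a `1`-form, at a
point. -/
def weylScreenFormAt (S : ScreenDistribution ξ) (D Dg : Connection n M) (α : OneForm n M) (p : M) :
    TangentSpace (𝓡 (n + 1)) p →L[ℝ] TangentSpace (𝓡 (n + 1)) p →L[ℝ] ℝ :=
  (α p).smulRight (S.η p) + (S.η p).smulRight (α p)
    - (ContinuousLinearMap.postcomp (TangentSpace (𝓡 (n + 1)) p) (S.η p)).comp
      (D.cov.difference Dg.cov p)

theorem weylScreenFormAt_apply (S : ScreenDistribution ξ) (D Dg : Connection n M)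
    (α : OneForm n M) (Y Z : VF n M) (p : M) : weylScreenFormAt S D Dg α p (Y p) (Z p) =
      α p (Y p) * S.η p (Z p) + S.η p (Y p) * α p (Z p)
        - S.η p (D.nabla Z Y p - Dg.nabla Z Y p) := by
  have h : D.cov.difference Dg.cov p (Y p) = D.cov Y p - Dg.cov Y p :=
    IsCovariantDerivativeOn.difference_apply _ _ (Set.mem_univ p) Y.mdifferentiableAt
  have e : weylScreenFormAt S D Dg α p (Y p) (Z p) = α p (Y p) * S.η p (Z p) +
      S.η p (Y p) * α p (Z p) - S.η p (D.cov.difference Dg.cov p (Y p) (Z p)) := rfl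
  rw [e, h]
  rfl

/-- The `ξ`-component of the difference tensor of two connections, corrected by a `1`-form. -/
def weylScreenForm [T2Space M] (S : ScreenDistribution ξ) (D Dg : Connection n M)
    (α : OneForm n M) : BilinForm n M :=
  BilinForm.mk' (weylScreenFormAt S D Dg α) fun Y Z ↦ by
    simp only [weylScreenFormAt_apply]
    exact (((α.contMDiff_apply Y).mul (S.η.contMDiff_apply Z)).add
      ((S.η.contMDiff_apply Y).mul (α.contMDiff_apply Z))).sub
        (S.η.contMDiff_apply (D.nablaVF Z Y - Dg.nablaVF Z Y))

theorem weylScreenForm_apply [T2Space M] (S : ScreenDistribution ξ) (D Dg : Connection n M)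
    (α : OneForm n M) (Y Z : VF n M) (p : M) : weylScreenForm S D Dg α p (Y p) (Z p) =
      α p (Y p) * S.η p (Z p) + S.η p (Y p) * α p (Z p)
        - S.η p (D.nabla Z Y p - Dg.nabla Z Y p) :=
  weylScreenFormAt_apply S D Dg α Y Z p

/-- A vector is determined by $g$ and $\eta$. Under $g$, formula (1) is the Koszul-type formula;
under $\eta$, it is the definition of `weylScreenForm`, read with its symmetry. -/
theorem IsWeylForm.isGivenBy [T2Space M] (hα : IsWeylForm D g α) (hn : 1 ≤ n)
    (hg : IsLightlike g ξ) (hgeo : IsTotallyGeodesic g ξ) (hD : D.IsTorsionFree)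
    (hDξ : ∀ p : M, D.nabla ξ ξ p = 0)
    (hS : ∀ X Y : VF n M, S.IsSection Y → ∀ p, D.nabla X Y p ∈ S.space p)
    (hDg : IsCompatibleConnection g ξ Dg) : IsGivenBy S D g Dg α (weylScreenForm S D Dg α) := by
  have hαξ := hα.apply_radical_eq_zero hn hg hgeo hD
  have hsymm (p : M) (X Y : VF n M) :
      D.nabla X Y p - Dg.nabla X Y p = D.nabla Y X p - Dg.nabla Y X p := by
    have h := (hD X Y p).trans (hDg.torsionFree X Y p).symm
    rw [sub_eq_sub_iff_sub_eq_sub]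
    exact h
  refine ⟨hαξ, fun p v w ↦ ?_, fun p ↦ ?_, fun X Y hY p ↦ ?_, fun X Y p ↦ ?_⟩
  · obtain ⟨Y, rfl⟩ := exists_vf_eq v
    obtain ⟨Z, rfl⟩ := exists_vf_eq w
    rw [weylScreenForm_apply, weylScreenForm_apply, hsymm]
    ring
  · rw [weylScreenForm_apply, hαξ, hDξ, hDg.geodesic]
    simp
  · have h1 : S.η p (Y p) = 0 := hY p
    have h2 : S.η p (D.nabla X Y p) = 0 := hS X Y hY p
    rw [weylScreenForm_apply, hsymm, map_sub, h1, h2, screenForm]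
    ring
  · refine hg.eq_of_apply_eq S (fun Z ↦ ?_) ?_
    · simp only [map_sub, map_add, map_smul, add_apply, sub_apply, smul_apply, smul_eq_mul,
        apply_sharp S hg (hαξ p), hg.apply_radical, hα.apply_nabla_sub hg hD hDg X Y Z]
      ring
    · rw [weylScreenForm_apply, hsymm]
      simp only [map_sub, map_add, map_smul, smul_eq_mul, η_sharp S hg (hαξ p), S.η_ξ]
      ring

/-! ## The compatible connection of a Weyl structure -/

/-- The tensor `(Y, X) ↦ g(X, Y) α^♯ - α(X) Y - α(Y) X`. -/
def weylDifference (g : BilinForm n M) (S : ScreenDistribution ξ) (α : OneForm n M) (p : M) :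
    TangentSpace (𝓡 (n + 1)) p →L[ℝ] TangentSpace (𝓡 (n + 1)) p →L[ℝ]
      TangentSpace (𝓡 (n + 1)) p :=
  LinearMap.toContinuousLinearMap
    { toFun := fun y ↦ (g p y).smulRight (sharp g S.η α p) - (α p).smulRight y
        - α p y • ContinuousLinearMap.id ℝ (TangentSpace (𝓡 (n + 1)) p)
      map_add' := fun y z ↦ by
        ext x
        simp only [map_add, add_apply, sub_apply, smul_apply, ContinuousLinearMap.smulRight_apply,
          ContinuousLinearMap.id_apply]
        module
      map_smul' := fun c y ↦ by
        ext x
        simp only [map_smul, sub_apply, smul_apply, ContinuousLinearMap.smulRight_apply,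
          ContinuousLinearMap.id_apply, RingHom.id_apply, smul_eq_mul]
        module }

theorem weylDifference_apply (hg : IsLightlike g ξ) (S : ScreenDistribution ξ) (α : OneForm n M)
    (p : M) (y x : TangentSpace (𝓡 (n + 1)) p) : weylDifference g S α p y x =
      g p x y • sharp g S.η α p - α p x • y - α p y • x := by
  rw [hg.symm p x y]
  rfl

/-- The connection `D_X Y - α(X) Y - α(Y) X + g(X, Y) α^♯`. -/
def weylConnection [T2Space M] (hg : IsLightlike g ξ) (S : ScreenDistribution ξ)
    (D : Connection n M) (α : OneForm n M) : Connection n M where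
  cov := D.cov.addOneForm (weylDifference g S α)
  smooth := ⟨⟨fun {Y} hY ↦ by
    -- Since $\infty+1=\infty$, the section is itself a smooth vector field, and smoothness of the
    -- derivative can be tested on each `X`.
    obtain ⟨Y, rfl⟩ : ∃ Y' : VF n M, Y' = Y := ⟨⟨Y, contMDiffOn_univ.1 hY⟩, rfl⟩
    refine (contMDiff_hom_of_apply _ fun X ↦ ?_).contMDiffOn
    convert (D.nablaVF X Y + (smulVF _ (g.contMDiff_apply X Y) (sharpVF S hg α)
      - smulVF _ (α.contMDiff_apply X) Y - smulVF _ (α.contMDiff_apply Y) X)).contMDiff using 3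
    change D.cov Y _ (X _) + weylDifference g S α _ (Y _) (X _) = _
    rw [weylDifference_apply hg]
    rfl⟩⟩

theorem weylConnection_nabla [T2Space M] (hg : IsLightlike g ξ) (S : ScreenDistribution ξ)
    (D : Connection n M) (α : OneForm n M) (X Y : ∀ p : M, TangentSpace (𝓡 (n + 1)) p) (p : M) :
    (weylConnection hg S D α).nabla X Y p = D.nabla X Y p + (g p (X p) (Y p) • sharp g S.η α p
      - α p (X p) • Y p - α p (Y p) • X p) := by
  rw [← weylDifference_apply hg]
  rfl

/-- This supplies the existence of $D^g$. The correction is symmetric, compensates the defect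
$-2\alpha\otimes g$, and vanishes on $(\xi,\xi)$ because $\alpha(\xi)=0$. -/
theorem IsWeylForm.isCompatibleConnection [T2Space M] (hα : IsWeylForm D g α)
    (hg : IsLightlike g ξ) (hαξ : ∀ p, α p (ξ p) = 0) (hD : D.IsTorsionFree)
    (hDξ : ∀ p : M, D.nabla ξ ξ p = 0) (S : ScreenDistribution ξ) :
    IsCompatibleConnection g ξ (weylConnection hg S D α) := by
  refine ⟨fun X Y p ↦ ?_, fun X Y Z p ↦ ?_, fun p ↦ ?_⟩
  · rw [weylConnection_nabla, weylConnection_nabla, ← hD X Y p, hg.symm p (Y p) (X p)]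
    abel
  · rw [Connection.derivBilin, weylConnection_nabla, weylConnection_nabla, hα.dirD_apply]
    simp only [map_add, map_sub, map_smul, add_apply, sub_apply, smul_apply, smul_eq_mul,
      apply_sharp S hg (hαξ p), hg.symm p (Y p) (sharp g S.η α p), hg.symm p (Y p) (X p)]
    ring
  · rw [weylConnection_nabla, hDξ, hαξ, hg.apply_radical]
    simp

/-! ## From the structure equations to the Weyl structure -/

namespace IsGivenBy

theorem isTorsionFree (h : IsGivenBy S D g Dg θ σ) (hg : IsLightlike g ξ)
    (hDg : Dg.IsTorsionFree) : D.IsTorsionFree := by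
  intro X Y p
  rw [h.formula, h.formula, ← hDg X Y p, hg.symm p (Y p) (X p), h.symm p (Y p) (X p)]
  abel

/-- The $\xi$-term is invisible to $g$, and the $\theta^\sharp$ terms cancel the terms with
$\theta(Y)$ and $\theta(Z)$, leaving the two copies of $\theta(X)g(Y,Z)$. -/
theorem isWeylForm (h : IsGivenBy S D g Dg θ σ) (hg : IsLightlike g ξ)
    (hDg : IsCompatibleConnection g ξ Dg) : IsWeylForm D g θ := by
  intro X Y Z p
  rw [Connection.derivBilin, h.formula, h.formula, hDg.dirD_apply]
  simp only [map_add, map_sub, map_smul, add_apply, sub_apply, smul_apply, smul_eq_mul,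
    apply_sharp S hg (h.horizontal p), hg.symm p (Y p) (sharp g S.η θ p), hg.symm p (Y p) (X p),
    hg.apply_radical, hg.apply_radical']
  ring

theorem screen_parallel (h : IsGivenBy S D g Dg θ σ) (hg : IsLightlike g ξ) (X Y : VF n M)
    (hY : S.IsSection Y) (p : M) : D.nabla X Y p ∈ S.space p := by
  have hY' : S.η p (Y p) = 0 := hY p
  change S.η p (D.nabla X Y p) = 0
  rw [h.formula]
  simp only [map_add, map_sub, map_smul, smul_eq_mul, η_sharp S hg (h.horizontal p), S.η_ξ, hY',
    h.screen X Y hY, screenForm]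
  ring

end IsGivenBy

theorem IsWeylForm.unique [T2Space M] (hn : 1 ≤ n) (hg : IsLightlike g ξ) (hα : IsWeylForm D g α)
    (hθ : IsWeylForm D g θ) : α = θ := by
  refine ContMDiffSection.ext fun p ↦ ?_
  obtain ⟨v, w, hvw⟩ := hg.exists_apply_ne_zero hn p
  obtain ⟨Y, rfl⟩ := exists_vf_eq v
  obtain ⟨Z, rfl⟩ := exists_vf_eq w
  ext x
  obtain ⟨X, rfl⟩ := exists_vf_eq x
  have h := mul_right_cancel₀ hvw ((hα X Y Z p).symm.trans (hθ X Y Z p))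
  linarith

end

end LightlikeWeyl

/-! ### Characterization of Einstein-Weyl screen structures -/

theorem mainTheorem3 (n : ℕ) (hn : 1 ≤ n)
    (M : Type*) [TopologicalSpace M] [T2Space M]
    [ChartedSpace (LightlikeWeyl.E n) M] [IsManifold (𝓡 (n + 1)) ∞ M]
    (g₀ : LightlikeWeyl.BilinForm n M) (ξ : LightlikeWeyl.VF n M)
    (hg₀ : LightlikeWeyl.IsLightlike g₀ ξ)
    (hgeo : LightlikeWeyl.IsTotallyGeodesic g₀ ξ)
    (S : LightlikeWeyl.ScreenDistribution ξ) (hS : S.IsIntegrable)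
    (D : LightlikeWeyl.Connection n M) (hD : ∀ p : M, D.nabla ξ ξ p = 0) :
    (LightlikeWeyl.IsEinsteinWeylScreenStructure (LightlikeWeyl.conformalClass g₀ ξ) S D ↔
      ∀ g ∈ LightlikeWeyl.conformalClass g₀ ξ,
        ∃ (Dg : LightlikeWeyl.Connection n M) (θ : LightlikeWeyl.OneForm n M)
          (σ : LightlikeWeyl.BilinForm n M) (Λ : LightlikeWeyl.SmoothFun n M),
          LightlikeWeyl.IsCompatibleConnection g ξ Dg ∧
          LightlikeWeyl.IsGivenBy S D g Dg θ σ ∧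
          LightlikeWeyl.RicciCondition S g Dg θ σ Λ) ∧
    (LightlikeWeyl.IsEinsteinWeylScreenStructure (LightlikeWeyl.conformalClass g₀ ξ) S D →
      ∀ g ∈ LightlikeWeyl.conformalClass g₀ ξ, ∀ Dg : LightlikeWeyl.Connection n M,
        LightlikeWeyl.IsCompatibleConnection g ξ Dg →
        ∃ (θ : LightlikeWeyl.OneForm n M) (σ : LightlikeWeyl.BilinForm n M)
          (Λ : LightlikeWeyl.SmoothFun n M),
          LightlikeWeyl.IsGivenBy S D g Dg θ σ ∧
          LightlikeWeyl.RicciCondition S g Dg θ σ Λ) ∧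
    (∀ g ∈ LightlikeWeyl.conformalClass g₀ ξ, ∀ Dg : LightlikeWeyl.Connection n M,
      LightlikeWeyl.IsCompatibleConnection g ξ Dg →
      ∀ (θ : LightlikeWeyl.OneForm n M) (σ : LightlikeWeyl.BilinForm n M),
        LightlikeWeyl.IsGivenBy S D g Dg θ σ →
        ∀ Λ : LightlikeWeyl.SmoothFun n M,
          LightlikeWeyl.IsEinsteinWeylFunction D g Λ ↔
            LightlikeWeyl.RicciCondition S g Dg θ σ Λ) := by
  open LightlikeWeyl in
  have hlight {g} (hg : g ∈ conformalClass g₀ ξ) : IsLightlike g ξ := hg₀.of_mem_conformalClass hg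
  have hb : IsEinsteinWeylScreenStructure (conformalClass g₀ ξ) S D →
      ∀ g ∈ conformalClass g₀ ξ, ∀ Dg : Connection n M, IsCompatibleConnection g ξ Dg →
        ∃ (θ : OneForm n M) (σ : BilinForm n M) (Λ : SmoothFun n M),
          IsGivenBy S D g Dg θ σ ∧ RicciCondition S g Dg θ σ Λ := by
    rintro ⟨⟨⟨hT, hW⟩, hSc⟩, hE⟩ g hg Dg hDg
    obtain ⟨α, hα, -⟩ := hW g hg
    obtain ⟨Λ, hΛ⟩ := hE g hg
    have h := hα.isGivenBy hn (hlight hg) (hgeo.of_mem_conformalClass hg) hT hD hSc hDg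
    exact ⟨α, _, Λ, h, (h.isEinsteinWeylFunction_iff (hlight hg) hDg Λ).1 hΛ⟩
  refine ⟨⟨fun h g hg ↦ ?_, fun h ↦ ⟨⟨⟨?_, fun g hg ↦ ?_⟩, ?_⟩, fun g hg ↦ ?_⟩⟩, hb,
    fun g hg Dg hDg θ σ h Λ ↦ h.isEinsteinWeylFunction_iff (hlight hg) hDg Λ⟩
  -- Part (b) holds for every compatible connection, so it is enough to have one: the correction of
  -- $D$ by its Weyl form.
  · obtain ⟨α, hα, -⟩ := h.1.1.2 g hg
    have hDg := hα.isCompatibleConnection (hlight hg) (hα.apply_radical_eq_zero hn (hlight hg)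
      (hgeo.of_mem_conformalClass hg) h.1.1.1) h.1.1.1 hD S
    obtain ⟨θ, σ, Λ, h1, h2⟩ := hb h g hg _ hDg
    exact ⟨_, θ, σ, Λ, hDg, h1, h2⟩
  -- Torsion-freeness does not involve the metric, so the representative $g_0$ suffices.
  · obtain ⟨Dg, θ, σ, Λ, hDg, h1, -⟩ := h g₀ (self_mem_conformalClass g₀ ξ)
    exact h1.isTorsionFree hg₀ hDg.torsionFree
  · obtain ⟨Dg, θ, σ, Λ, hDg, h1, -⟩ := h g hg
    have hθ := h1.isWeylForm (hlight hg) hDg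
    exact ⟨θ, hθ, fun α hα ↦ IsWeylForm.unique hn (hlight hg) hα hθ⟩
  · obtain ⟨Dg, θ, σ, Λ, hDg, h1, -⟩ := h g₀ (self_mem_conformalClass g₀ ξ)
    exact h1.screen_parallel hg₀
  · obtain ⟨Dg, θ, σ, Λ, hDg, h1, h2⟩ := h g hg
    exact ⟨Λ, (h1.isEinsteinWeylFunction_iff (hlight hg) hDg Λ).2 h2⟩
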